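/- Let $G$ be a finite connected simple graph with vertex set $\mathsf V$ and edge set $\mathsf E$, let $\ell\in(0,\infty)$, identify each edge $\mathsf e\in\mathsf E$ with the interval $[0,\ell]$ (this fixes an arbitrary orientation of the edge, with initial endpoint $0$ and terminal endpoint $\ell$), let $\mathsf v^*\in\mathsf V$, and let $\mathcal G_\infty$ be the metric graph obtained by attaching at $\mathsf v^*$ one lead $\mathsf e_0\cong[0,\infty)$, whose initial endpoint $0$ is $\mathsf v^*$. For every $\mathsf e\in\mathsf E$ let $q_{\mathsf e}\in L^2(0,\ell)$ be real-valued, and let $q_{\mathsf e_0}=0$. For a vertex $\mathsf v$ let $\mathsf E_{\mathsf v}^-$ and $\mathsf E_{\mathsf v}^+$ be the sets of edges of $\mathcal G_\infty$, including the lead, whose initial, respectively terminal, endpoint is $\mathsf v$. On the complex Hilbert space $L^2(\mathcal G_\infty)=L^2(0,\infty)\oplus\bigoplus_{\mathsf e\in\mathsf E}L^2(0,\ell)$ let $A$ be the operator $$A\,(y_{\mathsf e})_{\mathsf e}=(-y_{\mathsf e}''+q_{\mathsf e}y_{\mathsf e})_{\mathsf e}$$ whose domain $D(A)$ is the set of all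 $y\in L^2(\mathcal G_\infty)$ that are continuous on $\mathcal G_\infty$, have $y''\in L^2(\mathcal G_\infty)$ (on each edge $y_{\mathsf e}$ is continuously differentiable, $y_{\mathsf e}'$ is locally absolutely continuous, and $y_{\mathsf e}''$ is square integrable), and satisfy the Kirchhoff condition $$\sum_{\mathsf e\in\mathsf E_{\mathsf v}^-}y_{\mathsf e}'(0)=\sum_{\mathsf e\in\mathsf E_{\mathsf v}^+}y_{\mathsf e}'(\ell)\qquad\text{for all }\mathsf v\in\mathsf V .$$ A normal eigenvalue of $A$ is an eigenvalue of finite multiplicity that is an isolated point of the spectrum $\sigma(A)$; the essential spectrum $\sigma_{\mathrm{ess}}(A)$ is $\sigma(A)$ without the normal eigenvalues. Then $A$ is self-adjoint and bounded from below, $\sigma_{\mathrm{ess}}(A)=[0,\infty)$, and $\sigma(A)\cap(-\infty,0)$ consists of at most finitely many normal eigenvalues. -/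

import Mathlib

open MeasureTheory Set
open scoped InnerProductSpace

noncomputable section

/-! ### Unbounded operators on a complex Hilbert space -/

namespace LinearPMap

variable {H : Type*} [NormedAddCommGroup H] [InnerProductSpace ℂ H]

/-- The operator `A` is bounded from below: `c ‖y‖² ≤ ⟪A y, y⟫` on its domain, for some real `c`. -/
def IsBoundedFromBelow (A : H →ₗ.[ℂ] H) : Prop :=
  ∃ c : ℝ, ∀ y : A.domain, c * ‖(y : H)‖ ^ 2 ≤ (⟪A y, (y : H)⟫_ℂ).re

/-- The resolvent set: those `z` for which `z - A` is a bijection from the domain of `A` onto the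
whole space with a bounded everywhere defined inverse `R`. -/
def resolvents (A : H →ₗ.[ℂ] H) : Set ℂ :=
  {z | ∃ R : H →L[ℂ] H,
    (∀ y : A.domain, R (z • (y : H) - A y) = y) ∧
    (∀ f : H, ∃ y : A.domain, (y : H) = R f ∧ z • (y : H) - A y = f)}

/-- The spectrum: the complement of the resolvent set. -/
def spec (A : H →ₗ.[ℂ] H) : Set ℂ := (A.resolvents)ᶜ

/-- The eigenspace `{y ∈ D(A) | A y = z y}`, as a subspace of the domain. -/
def eigenspaceAt (A : H →ₗ.[ℂ] H) (z : ℂ) : Submodule ℂ A.domain :=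
  LinearMap.ker (A.toFun - z • A.domain.subtype)

/-- Normal eigenvalues: eigenvalues of finite multiplicity that are isolated points of the
spectrum. (For a self-adjoint operator algebraic and geometric multiplicities agree.) -/
def normalEigenvalues (A : H →ₗ.[ℂ] H) : Set ℂ :=
  {z | A.eigenspaceAt z ≠ ⊥ ∧ FiniteDimensional ℂ (A.eigenspaceAt z) ∧
    ∃ ε > 0, ∀ w ∈ A.spec, dist w z < ε → w = z}

/-- The essential spectrum: the part of the spectrum that does not consist of normal
eigenvalues. -/
def essSpec (A : H →ₗ.[ℂ] H) : Set ℂ := A.spec \ A.normalEigenvalues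

end LinearPMap

/-! ### An equilateral metric graph with one lead

The combinatorial graph is a simple graph `G`; each edge `e` is identified with `[0, ℓ]`, directed
from `src e` to `tgt e`. The edges of the graph with the lead are the elements of
`Option G.edgeSet`; `none` is the lead, identified with `[0, ∞)`. -/

/-- An orientation of a simple graph: a choice of the initial and of the terminal endpoint of
every edge. -/
structure EdgeOrientation {V : Type*} (G : SimpleGraph V) where
  src : G.edgeSet → V
  tgt : G.edgeSet → V
  endpoints : ∀ e : G.edgeSet, s(src e, tgt e) = (e : Sym2 V)

namespace LeadGraph

/-- The interval that parametrizes an edge: `[0, ∞)` for the lead and `[0, ℓ]` for the others. -/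
def edgeInterval {E : Type*} (ℓ : ℝ) : Option E → Set ℝ
  | none => Ici 0
  | some _ => Icc 0 ℓ

/-- The initial vertex of an edge; the lead is directed away from the root. -/
def initialVertex {V : Type*} {G : SimpleGraph V} (o : EdgeOrientation G) (root : V) :
    Option G.edgeSet → V
  | none => root
  | some e => o.src e

/-- The potential on all edges: the given one on the finite edges, zero on the lead. -/
def extendByZero {E : Type*} (q : E → ℝ → ℝ) : Option E → ℝ → ℝ
  | none => fun _ => 0
  | some e => q e

/-- The Hilbert space `L²(0, ∞) ⊕ ⨁ₑ L²(0, ℓ)` of complex-valued functions. -/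
abbrev L2Space (E : Type*) (ℓ : ℝ) : Type _ :=
  PiLp 2 (fun e : Option E => Lp ℂ 2 (volume.restrict (edgeInterval ℓ e)))

/-- `f` agrees a.e. on the interval `J` (with left endpoint `0`) with the function `u`, which is
differentiable on `J` with derivative `u'`, where `u'` is locally absolutely continuous on `J` and
its a.e. derivative `u''` is in `L²(J)`. For bounded `J` this says `f ∈ H²(J)`. -/
structure IsH2Rep (J : Set ℝ) (f u u' u'' : ℝ → ℂ) : Prop where
  ae_eq : f =ᵐ[volume.restrict J] u
  deriv_one : ∀ x ∈ J, HasDerivWithinAt u (u' x) J x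
  abs_cont : ∀ b ∈ J, AbsolutelyContinuousOnInterval u' 0 b
  deriv_two : ∀ᵐ x ∂(volume.restrict J), HasDerivWithinAt u' (u'' x) J x
  memLp_two : MemLp u'' 2 (volume.restrict J)

/-- Continuity at the vertices: the endpoint values of `u` on the edges, including the lead, are
given by a function `c` on the vertices. -/
def ContinuousAtVertices {V : Type*} {G : SimpleGraph V} (o : EdgeOrientation G) (root : V) (ℓ : ℝ)
    (u : Option G.edgeSet → ℝ → ℂ) : Prop :=
  ∃ c : V → ℂ, (∀ e, u e 0 = c (initialVertex o root e)) ∧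
    ∀ e : G.edgeSet, u (some e) ℓ = c (o.tgt e)

/-- The Kirchhoff condition at every vertex, `u'` being the derivatives along the edges. The lead
is among the edges that start at the root. -/
def Kirchhoff {V : Type*} [DecidableEq V] {G : SimpleGraph V} [Fintype G.edgeSet]
    (o : EdgeOrientation G) (root : V) (ℓ : ℝ) (u' : Option G.edgeSet → ℝ → ℂ) : Prop :=
  ∀ v : V, ∑ e with o.tgt e = v, u' (some e) ℓ = ∑ e with initialVertex o root e = v, u' e 0

/-- `(y, w)` is in the graph of the Schrödinger operator: `y` and `y''` are square integrable, `y`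
satisfies the standard conditions at all vertices, and `w = -y'' + q y` on every edge. -/
def IsGraphPair {V : Type*} [DecidableEq V] {G : SimpleGraph V} [Fintype G.edgeSet]
    (o : EdgeOrientation G) (root : V) (ℓ : ℝ) (q : G.edgeSet → ℝ → ℝ)
    (y w : L2Space G.edgeSet ℓ) : Prop :=
  ∃ u u' u'' : Option G.edgeSet → ℝ → ℂ,
    (∀ e, IsH2Rep (edgeInterval ℓ e) (y e) (u e) (u' e) (u'' e)) ∧
    ContinuousAtVertices o root ℓ u ∧
    Kirchhoff o root ℓ u' ∧
    ∀ e, w e =ᵐ[volume.restrict (edgeInterval ℓ e)]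
      fun x => -u'' e x + (extendByZero q e x : ℂ) * u e x

theorem absolutelyContinuousOnInterval_smul (z : ℂ) {f : ℝ → ℂ} {a b : ℝ}
    (hf : AbsolutelyContinuousOnInterval f a b) :
    AbsolutelyContinuousOnInterval (fun x => z * f x) a b := by
  unfold AbsolutelyContinuousOnInterval at hf ⊢
  have h := hf.const_mul ‖z‖
  simpa [Finset.mul_sum, dist_eq_norm, ← mul_sub] using h

theorem IsH2Rep.add {J : Set ℝ} {f g F u u' u'' v v' v'' : ℝ → ℂ} (h : IsH2Rep J f u u' u'')
    (k : IsH2Rep J g v v' v'') (hF : F =ᵐ[volume.restrict J] fun x => f x + g x) :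
    IsH2Rep J F (fun x => u x + v x) (fun x => u' x + v' x) (fun x => u'' x + v'' x) where
  ae_eq := by
    filter_upwards [hF, h.ae_eq, k.ae_eq] with x h1 h2 h3
    rw [h1, h2, h3]
  deriv_one x hx := (h.deriv_one x hx).add (k.deriv_one x hx)
  abs_cont b hb := (h.abs_cont b hb).add (k.abs_cont b hb)
  deriv_two := by
    filter_upwards [h.deriv_two, k.deriv_two] with x h1 h2
    exact h1.add h2
  memLp_two := h.memLp_two.add k.memLp_two

theorem IsH2Rep.smul {J : Set ℝ} {f F u u' u'' : ℝ → ℂ} (z : ℂ) (h : IsH2Rep J f u u' u'')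
    (hF : F =ᵐ[volume.restrict J] fun x => z * f x) :
    IsH2Rep J F (fun x => z * u x) (fun x => z * u' x) (fun x => z * u'' x) where
  ae_eq := by
    filter_upwards [hF, h.ae_eq] with x h1 h2
    rw [h1, h2]
  deriv_one x hx := (h.deriv_one x hx).const_mul z
  abs_cont b hb := absolutelyContinuousOnInterval_smul z (h.abs_cont b hb)
  deriv_two := by
    filter_upwards [h.deriv_two] with x h1
    exact h1.const_mul z
  memLp_two := h.memLp_two.const_mul z

theorem IsH2Rep.zero (J : Set ℝ) {f : ℝ → ℂ} (hf : f =ᵐ[volume.restrict J] fun _ => 0) :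
    IsH2Rep J f (fun _ => 0) (fun _ => 0) (fun _ => 0) where
  ae_eq := hf
  deriv_one x _ := hasDerivWithinAt_const x J 0
  abs_cont b _ := by
    have h : LipschitzWith 0 (fun _ : ℝ => (0 : ℂ)) := LipschitzWith.const 0
    exact h.lipschitzOnWith.absolutelyContinuousOnInterval
  deriv_two := Filter.Eventually.of_forall fun x => hasDerivWithinAt_const x J 0
  memLp_two := MemLp.zero'

/-- The graph of the Schrödinger operator. -/
def schrodingerGraph {V : Type*} [DecidableEq V] {G : SimpleGraph V} [Fintype G.edgeSet]
    (o : EdgeOrientation G) (root : V) (ℓ : ℝ) (q : G.edgeSet → ℝ → ℝ) :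
    Submodule ℂ (L2Space G.edgeSet ℓ × L2Space G.edgeSet ℓ) where
  carrier := {p | IsGraphPair o root ℓ q p.1 p.2}
  zero_mem' := by
    refine ⟨fun _ _ => 0, fun _ _ => 0, fun _ _ => 0, fun e => IsH2Rep.zero _ ?_,
      ⟨fun _ => 0, fun _ => rfl, fun _ => rfl⟩, fun v => by simp, fun e => ?_⟩
    · exact Lp.coeFn_zero _ _ _
    · filter_upwards [Lp.coeFn_zero ℂ 2 (volume.restrict (edgeInterval ℓ e))] with x hx
      simpa using hx
  add_mem' := by
    rintro ⟨y, w⟩ ⟨z, t⟩ ⟨u, u', u'', h1, ⟨c, h2, h3⟩, h4, h5⟩ ⟨v, v', v'', k1, ⟨d, k2, k3⟩, k4, k5⟩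
    refine ⟨fun e x => u e x + v e x, fun e x => u' e x + v' e x, fun e x => u'' e x + v'' e x,
      fun e => (h1 e).add (k1 e) (Lp.coeFn_add _ _),
      ⟨fun x => c x + d x, fun e => congrArg₂ _ (h2 e) (k2 e),
        fun e => congrArg₂ _ (h3 e) (k3 e)⟩, fun x => ?_,
      fun e => ?_⟩
    · have a := h4 x
      have b := k4 x
      simp only [Finset.sum_add_distrib, a, b]
    · filter_upwards [Lp.coeFn_add (w e) (t e), h5 e, k5 e] with x a b c
      refine a.trans ?_
      rw [Pi.add_apply, b, c]
      ring
  smul_mem' := by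
    rintro z ⟨y, w⟩ ⟨u, u', u'', h1, ⟨c, h2, h3⟩, h4, h5⟩
    refine ⟨fun e x => z * u e x, fun e x => z * u' e x, fun e x => z * u'' e x,
      fun e => (h1 e).smul z (Lp.coeFn_smul _ _),
      ⟨fun x => z * c x, fun e => congrArg _ (h2 e), fun e => congrArg _ (h3 e)⟩, fun x => ?_, fun e => ?_⟩
    · have a := h4 x
      simp only [← Finset.mul_sum, a]
    · filter_upwards [Lp.coeFn_smul z (w e), h5 e] with x a b
      refine a.trans ?_
      rw [Pi.smul_apply, b, smul_eq_mul]
      ring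

/-- The Schrödinger operator `A y = -y'' + q y` on the graph with a lead, with zero potential on
the lead and standard conditions at all vertices. -/
def schrodingerOperator {V : Type*} [DecidableEq V] {G : SimpleGraph V} [Fintype G.edgeSet]
    (o : EdgeOrientation G) (root : V) (ℓ : ℝ) (q : G.edgeSet → ℝ → ℝ) :
    L2Space G.edgeSet ℓ →ₗ.[ℂ] L2Space G.edgeSet ℓ :=
  (schrodingerGraph o root ℓ q).toLinearPMap

theorem IsH2Rep.second_eq_zero {E : Type*} {ℓ : ℝ} (hℓ : 0 < ℓ) (e : Option E)
    {f u u' u'' : ℝ → ℂ} (h : IsH2Rep (edgeInterval ℓ e) f u u' u'')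
    (hf : f =ᵐ[volume.restrict (edgeInterval ℓ e)] fun _ => 0) :
    (∀ x ∈ edgeInterval ℓ e, u x = 0) ∧ u'' =ᵐ[volume.restrict (edgeInterval ℓ e)] fun _ => 0 := by
  have hJ : UniqueDiffOn ℝ (edgeInterval ℓ e) ∧
      edgeInterval ℓ e ⊆ closure (interior (edgeInterval ℓ e)) ∧
      MeasurableSet (edgeInterval ℓ e) := by
    cases e with
    | none =>
      refine ⟨uniqueDiffOn_Ici 0, ?_, measurableSet_Ici⟩
      simp [edgeInterval]
    | some e =>
      refine ⟨uniqueDiffOn_Icc hℓ, ?_, measurableSet_Icc⟩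
      simp [edgeInterval, closure_Ioo hℓ.ne]
  obtain ⟨hU, hcl, hm⟩ := hJ
  have hu : EqOn u (fun _ => 0) (edgeInterval ℓ e) := by
    refine Measure.eqOn_of_ae_eq (h.ae_eq.symm.trans hf)
      (fun x hx => (h.deriv_one x hx).continuousWithinAt) continuousOn_const hcl
  have hu' : ∀ x ∈ edgeInterval ℓ e, u' x = 0 := fun x hx =>
    (hU x hx).eq_deriv _ (h.deriv_one x hx)
      ((hasDerivWithinAt_const x _ (0 : ℂ)).congr (fun t ht => hu ht) (hu hx))
  refine ⟨hu, ?_⟩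
  filter_upwards [h.deriv_two, ae_restrict_mem hm] with x h1 hx
  exact (hU x hx).eq_deriv _ h1
    ((hasDerivWithinAt_const x _ (0 : ℂ)).congr (fun t ht => hu' t ht) (hu' x hx))

/-- The graph of the operator is the set described in `IsGraphPair`. -/
theorem mem_graph_schrodingerOperator {V : Type*} [DecidableEq V] {G : SimpleGraph V}
    [Fintype G.edgeSet] (o : EdgeOrientation G) (root : V) {ℓ : ℝ} (hℓ : 0 < ℓ)
    (q : G.edgeSet → ℝ → ℝ) (y w : L2Space G.edgeSet ℓ) :
    (y, w) ∈ (schrodingerOperator o root ℓ q).graph ↔ IsGraphPair o root ℓ q y w := by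
  rw [schrodingerOperator, Submodule.toLinearPMap_graph_eq]
  · rfl
  · rintro ⟨y, w⟩ ⟨u, u', u'', h1, -, -, h4⟩ (rfl : y = 0)
    ext1 e
    have hz := (h1 e).second_eq_zero hℓ e (Lp.coeFn_zero _ _ _)
    have hm : MeasurableSet (edgeInterval ℓ e) := by
      cases e
      · exact measurableSet_Ici
      · exact measurableSet_Icc
    refine Lp.ext ?_
    refine Filter.EventuallyEq.trans ?_ (Lp.coeFn_zero ℂ 2 _).symm
    filter_upwards [h4 e, hz.2, ae_restrict_mem hm] with x a b hx
    rw [a, b, hz.1 x hx]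
    simp

end LeadGraph

end

noncomputable section

open Filter Topology ComplexConjugate

/-! ### Symmetric operators: surjectivity, self-adjointness and the resolvent set -/

namespace LinearPMap

variable {H : Type*} [NormedAddCommGroup H] [InnerProductSpace ℂ H]

/-! The spectral statements follow abstractly (`LinearPMap.spectral_properties`) from four facts
about the operator `A`. (1) `A` is symmetric: Green's formula holds on every edge, and the boundary
terms cancel vertex by vertex because continuity pairs with the Kirchhoff condition. (2) The form
satisfies `⟪A y, y⟫ ≥ -‖T y‖²` for a bounded `T` of finite rank. The lead contributes `∫ ‖u'‖² ≥ 0`.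
A finite edge is cut into intervals so short that the kinetic energy absorbs the potential up to the
squared modulus of the integral of `u` over each piece. (3) Off `[0, ∞)`, injectivity of `A - z`
implies surjectivity. With `z = -κ²` and `Re κ > 0`, the equation is solvable on each edge
separately, with one decaying homogeneous solution on the lead and two on each finite edge. Meeting
the vertex conditions is then a square linear system (`surjective_of_injective`). (4) Every `r ≥ 0`
is an approximate eigenvalue, by slowly decaying waves supported on the lead.

By (2), `A + ‖T‖² + 1` is injective, hence surjective by (3), and a symmetric operator with a
surjective real shift is densely defined and self-adjoint. It is therefore closed, so by (3) and the
closed graph theorem a spectral point off `[0, ∞)` is an eigenvalue, which symmetry forces to be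
real and thus negative. On a span of eigenvectors for distinct negative eigenvalues the form is
negative definite, so `T` is injective there. This bounds the number of such eigenvalues by the
dimension of the target of `T`, and the same argument bounds each multiplicity. By (4) all of `[0,
∞)` is spectrum, and none of its points is isolated. No compactness or perturbation theory for the
essential spectrum is needed. -/

theorem eq_zero_of_map_eq_smul_of_im_ne_zero {A : H →ₗ.[ℂ] H} (hA : A.IsFormalAdjoint A) {z : ℂ}
    (hz : z.im ≠ 0) (y : A.domain) (hy : A y = z • (y : H)) : y = 0 := by
  have h := hA y y
  rw [hy, inner_smul_left, inner_smul_right] at h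
  have h2 : (starRingEnd ℂ z - z) * ⟪(y : H), (y : H)⟫_ℂ = 0 := by rw [sub_mul, h, sub_self]
  rcases mul_eq_zero.1 h2 with h3 | h3
  · exact absurd (Complex.conj_eq_iff_im.1 (sub_eq_zero.1 h3)) hz
  · exact Subtype.ext (inner_self_eq_zero.1 h3)

theorem inner_re_eq_of_map_eq_smul {A : H →ₗ.[ℂ] H} {r : ℝ} (y : A.domain)
    (hy : A y = (r : ℂ) • (y : H)) : (⟪A y, (y : H)⟫_ℂ).re = r * ‖(y : H)‖ ^ 2 := by
  rw [hy, inner_smul_left, Complex.conj_ofReal, Complex.re_ofReal_mul]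
  congr 1
  exact (norm_sq_eq_re_inner (𝕜 := ℂ) (y : H)).symm

/-- If `f` is orthogonal to the domain, write `f = (A - r) u` and `u = (A - r) w`. Symmetry gives `0
= ⟪(A - r) u, w⟫ = ⟪u, (A - r) w⟫ = ‖u‖²`. Density therefore need not be checked by hand for the
concrete operator. -/
theorem dense_domain_of_surjective {A : H →ₗ.[ℂ] H} [CompleteSpace H] (hA : A.IsFormalAdjoint A)
    (r : ℝ) (hs : ∀ f : H, ∃ y : A.domain, A y - (r : ℂ) • (y : H) = f) :
    Dense (A.domain : Set H) := by
  rw [Submodule.dense_iff_topologicalClosure_eq_top, Submodule.topologicalClosure_eq_top_iff,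
    Submodule.eq_bot_iff]
  intro f hf
  obtain ⟨u, rfl⟩ := hs f
  obtain ⟨w, hw⟩ := hs u
  have h := Submodule.inner_left_of_mem_orthogonal w.2 hf
  rw [inner_sub_left, hA u w, inner_smul_left, Complex.conj_ofReal, ← inner_smul_right,
    ← inner_sub_right, hw, inner_self_eq_zero] at h
  have hu : u = 0 := Subtype.ext h
  simp [hu]

/-- For `y` in the domain of the adjoint, choose `u` in the domain of `A` with `(A - r) u = (A* - r)
y`. Then `y - u` is orthogonal to the range of `A - r`, which is everything, so `y = u`. -/
theorem isSelfAdjoint_of_surjective {A : H →ₗ.[ℂ] H} [CompleteSpace H] (hA : A.IsFormalAdjoint A)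
    (r : ℝ) (hs : ∀ f : H, ∃ y : A.domain, A y - (r : ℂ) • (y : H) = f) : IsSelfAdjoint A := by
  have hd := dense_domain_of_surjective hA r hs
  rw [isSelfAdjoint_def]
  have hle : A ≤ A.adjoint := hA.le_adjoint hd
  refine (LinearPMap.eq_of_le_of_domain_eq hle (le_antisymm hle.1 ?_)).symm
  intro y hy
  obtain ⟨u, hu⟩ := hs (A.adjoint ⟨y, hy⟩ - (r : ℂ) • y)
  have hadj := A.adjoint_isFormalAdjoint hd
  obtain ⟨v, hv⟩ := hs (y - u)
  have h1 := hadj ⟨y, hy⟩ v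
  have h2 := hA u v
  have h3 : ⟪y - u, A v - (r : ℂ) • (v : H)⟫_ℂ = 0 := by
    have : ⟪A.adjoint ⟨y, hy⟩ - (r : ℂ) • y - (A u - (r : ℂ) • (u : H)), (v : H)⟫_ℂ = 0 := by
      rw [hu]; simp
    rw [inner_sub_left, inner_sub_left, inner_sub_left, h1, h2, inner_smul_left, inner_smul_left,
      Complex.conj_ofReal] at this
    rw [inner_sub_left, inner_sub_right, inner_sub_right, inner_smul_right, inner_smul_right]
    linear_combination this
  rw [hv, inner_self_eq_zero, sub_eq_zero] at h3
  rw [h3]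
  exact u.2

/-- The closed graph theorem: the graph of the inverse of `z - A` is the preimage of the closed
graph of `A` under the continuous map `(f, g) ↦ (g, z g - f)`. -/
theorem mem_resolvents_of_bijective {A : H →ₗ.[ℂ] H} [CompleteSpace H] (hc : A.IsClosed) {z : ℂ}
    (hi : ∀ y : A.domain, A y = z • (y : H) → y = 0)
    (hs : ∀ f : H, ∃ y : A.domain, A y - z • (y : H) = f) : z ∈ A.resolvents := by
  let B : A.domain →ₗ[ℂ] H := z • A.domain.subtype - A.toFun
  have hB : ∀ y : A.domain, B y = z • (y : H) - A y := fun y => rfl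
  have hBi : Function.Injective B := by
    rw [injective_iff_map_eq_zero]
    intro y hy
    exact hi y (sub_eq_zero.1 (by rw [← hB, hy] : z • (y : H) - A y = 0)).symm
  have hBs : Function.Surjective B := by
    intro f
    obtain ⟨y, hy⟩ := hs (-f)
    exact ⟨y, by rw [hB, ← neg_sub, hy, neg_neg]⟩
  let e := LinearEquiv.ofBijective B ⟨hBi, hBs⟩
  let R : H →ₗ[ℂ] H := A.domain.subtype ∘ₗ e.symm.toLinearMap
  have hR : ∀ f : H, R f = (e.symm f : H) := fun f => rfl
  have hgr : _root_.IsClosed (R.graph : Set (H × H)) := by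
    have hpre : (R.graph : Set (H × H)) =
        (fun p : H × H => (p.2, z • p.2 - p.1)) ⁻¹' (A.graph : Set (H × H)) := by
      ext ⟨f, g⟩
      simp only [SetLike.mem_coe, LinearMap.mem_graph_iff, Set.mem_preimage,
        LinearPMap.mem_graph_iff]
      constructor
      · rintro rfl
        refine ⟨e.symm f, rfl, ?_⟩
        have h := e.apply_symm_apply f
        change B (e.symm f) = f at h
        rw [hB] at h
        rw [hR]
        nth_rw 3 [← h]
        abel
      · rintro ⟨y, rfl, hy⟩
        have h : e y = f := by
          change B y = f
          rw [hB, hy]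
          abel
        rw [hR, ← h, e.symm_apply_apply]
    rw [hpre]
    exact _root_.IsClosed.preimage (by fun_prop) hc
  refine ⟨ContinuousLinearMap.ofIsClosedGraph hgr, fun y => ?_, fun f => ⟨e.symm f, rfl, ?_⟩⟩
  · change (e.symm (B y) : H) = y
    rw [show B y = e y from rfl, e.symm_apply_apply]
  · exact e.apply_symm_apply f

theorem mem_spec_of_approx {A : H →ₗ.[ℂ] H} {z : ℂ}
    (h : ∀ ε > 0, ∃ y : A.domain, ‖z • (y : H) - A y‖ < ε * ‖(y : H)‖) : z ∈ A.spec := by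
  rintro ⟨R, hR, -⟩
  -- The summand `1` keeps the inverse meaningful when `‖R‖ = 0`.
  obtain ⟨y, hy⟩ := h (‖R‖ + 1)⁻¹ (by positivity)
  have h1 : ‖(y : H)‖ ≤ ‖R‖ * ‖z • (y : H) - A y‖ := by
    conv_lhs => rw [← hR y]
    exact R.le_opNorm _
  have h0 : 0 ≤ ‖z • (y : H) - A y‖ := norm_nonneg _
  have h2 : (‖R‖ + 1) * ‖z • (y : H) - A y‖ < ‖(y : H)‖ := by
    calc _ < (‖R‖ + 1) * ((‖R‖ + 1)⁻¹ * ‖(y : H)‖) := by gcongr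
      _ = _ := by field_simp
  nlinarith

theorem mem_eigenspaceAt {A : H →ₗ.[ℂ] H} {z : ℂ} {y : A.domain} :
    y ∈ A.eigenspaceAt z ↔ A y = z • (y : H) := by
  rw [eigenspaceAt, LinearMap.mem_ker]
  exact sub_eq_zero

/-! ### Spectral consequences of a form bound of finite rank -/

section FiniteRankBound

variable {F : Type*} [NormedAddCommGroup F] [NormedSpace ℂ F] [FiniteDimensional ℂ F]

/-- `T` is injective on the eigenspace: there the form equals `r ‖y‖²` with `r < 0`, while on the
kernel of `T` it is nonnegative. -/
theorem finiteDimensional_eigenspaceAt {A : H →ₗ.[ℂ] H} (T : H →L[ℂ] F)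
    (hT : ∀ y : A.domain, -‖T y‖ ^ 2 ≤ (⟪A y, (y : H)⟫_ℂ).re) {r : ℝ} (hr : r < 0) :
    FiniteDimensional ℂ (A.eigenspaceAt r) := by
  let S : A.eigenspaceAt r →ₗ[ℂ] F :=
    T.toLinearMap ∘ₗ A.domain.subtype ∘ₗ (A.eigenspaceAt r).subtype
  refine FiniteDimensional.of_injective S ?_
  rw [injective_iff_map_eq_zero]
  rintro ⟨y, hy⟩ h
  have h0 : T (y : H) = 0 := h
  have h1 := hT y
  rw [inner_re_eq_of_map_eq_smul y (mem_eigenspaceAt.1 hy), h0] at h1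
  have h2 : ‖(y : H)‖ ^ 2 = 0 := by
    have := sq_nonneg ‖(y : H)‖
    simp only [norm_zero] at h1
    nlinarith
  have h3 : y = 0 := Subtype.ext (by simpa using h2)
  exact Subtype.ext h3

/-- With more distinct negative eigenvalues than the dimension of `F`, some nontrivial combination
of eigenvectors lies in the kernel of `T`, where the form is nonnegative. Eigenvectors for distinct
eigenvalues are orthogonal, so the form of that combination is also a negative sum. -/
theorem finite_negative_eigenvalues {A : H →ₗ.[ℂ] H} (hA : A.IsFormalAdjoint A) (T : H →L[ℂ] F)
    (hT : ∀ y : A.domain, -‖T y‖ ^ 2 ≤ (⟪A y, (y : H)⟫_ℂ).re) :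
    {r : ℝ | r < 0 ∧ ∃ y : A.domain, y ≠ 0 ∧ A y = (r : ℂ) • (y : H)}.Finite := by
  by_contra hinf
  obtain ⟨s, hs, hcard⟩ := (show Set.Infinite _ from hinf).exists_subset_card_eq
    (Module.finrank ℂ F + 1)
  have hs' : ∀ r : s, (r : ℝ) < 0 ∧ ∃ y : A.domain, y ≠ 0 ∧ A y = ((r : ℝ) : ℂ) • (y : H) :=
    fun r => hs r.2
  choose hneg y hy0 hy using hs'
  have hdep : ¬ LinearIndependent ℂ (fun r : s => T (y r)) := by
    intro h
    have := h.fintype_card_le_finrank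
    rw [Fintype.card_coe, hcard] at this
    omega
  rw [Fintype.not_linearIndependent_iff] at hdep
  obtain ⟨a, ha, r₀, hr₀⟩ := hdep
  have horth : ∀ r t : s, r ≠ t → ⟪(y r : H), (y t : H)⟫_ℂ = 0 := by
    intro r t hrt
    have h := hA (y r) (y t)
    rw [hy, hy, inner_smul_left, inner_smul_right, Complex.conj_ofReal] at h
    have h2 : (((r : ℝ) : ℂ) - ((t : ℝ) : ℂ)) * ⟪(y r : H), (y t : H)⟫_ℂ = 0 := by
      rw [sub_mul, h, sub_self]
    rcases mul_eq_zero.1 h2 with h3 | h3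
    · exact absurd (Subtype.ext (Complex.ofReal_injective (sub_eq_zero.1 h3))) hrt
    · exact h3
  let w : A.domain := ∑ r, a r • y r
  have hw : (w : H) = ∑ r, a r • (y r : H) := by simp [w]
  have hAw : A w = ∑ r, a r • (((r : ℝ) : ℂ) • (y r : H)) := by
    rw [← LinearPMap.toFun_eq_coe]
    simp only [w, map_sum]
    refine Finset.sum_congr rfl fun r _ => ?_
    rw [← hy r]
    exact A.toFun.map_smul _ _
  have hTw : T (w : H) = 0 := by
    rw [hw, map_sum, ← ha]
    simp
  have hform : (⟪A w, (w : H)⟫_ℂ).re = ∑ r : s, (r : ℝ) * (‖a r‖ ^ 2 * ‖(y r : H)‖ ^ 2) := by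
    rw [hAw, hw, sum_inner, Complex.re_sum]
    refine Finset.sum_congr rfl fun r _ => ?_
    rw [inner_sum, Finset.sum_eq_single r]
    · rw [inner_smul_left, inner_smul_left, inner_smul_right, Complex.conj_ofReal,
        inner_self_eq_norm_sq_to_K]
      have : starRingEnd ℂ (a r) * (((r : ℝ) : ℂ) * (a r * (((‖(y r : H)‖ : ℝ) : ℂ) ^ 2))) =
          (((r : ℝ) * (‖a r‖ ^ 2 * ‖(y r : H)‖ ^ 2) : ℝ) : ℂ) := by
        push_cast
        rw [← Complex.mul_conj']
        ring
      exact (congrArg Complex.re this).trans (Complex.ofReal_re _)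
    · intro t _ ht
      rw [inner_smul_left, inner_smul_left, inner_smul_right, horth r t ht.symm]
      simp
    · simp
  have h1 := hT w
  rw [hTw, hform] at h1
  have h2 : ∑ r : s, (r : ℝ) * (‖a r‖ ^ 2 * ‖(y r : H)‖ ^ 2) < 0 := by
    refine Finset.sum_neg' (fun r _ => ?_) ⟨r₀, Finset.mem_univ _, ?_⟩
    · exact mul_nonpos_of_nonpos_of_nonneg (hneg r).le (by positivity)
    · have : (y r₀ : H) ≠ 0 := fun h => hy0 r₀ (Subtype.ext h)
      exact mul_neg_of_neg_of_pos (hneg r₀) (by positivity)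
  rw [norm_zero] at h1
  linarith

/-- A symmetric operator whose form is bounded below by a form of finite rank, for which `A - z`
is surjective as soon as it is injective off `[0, ∞)`, and for which every point of `[0, ∞)` is an
approximate eigenvalue. -/
theorem spectral_properties {A : H →ₗ.[ℂ] H} [CompleteSpace H] (hA : A.IsFormalAdjoint A)
    (T : H →L[ℂ] F)
    (hT : ∀ y : A.domain, -‖T y‖ ^ 2 ≤ (⟪A y, (y : H)⟫_ℂ).re)
    (hsurj : ∀ z : ℂ, z ∉ (fun x : ℝ => (x : ℂ)) '' Ici 0 →
      (∀ y : A.domain, A y = z • (y : H) → y = 0) →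
      ∀ f : H, ∃ y : A.domain, A y - z • (y : H) = f)
    (happrox : ∀ r : ℝ, 0 ≤ r → ∀ ε > 0, ∃ y : A.domain,
      ‖(r : ℂ) • (y : H) - A y‖ < ε * ‖(y : H)‖) :
    IsSelfAdjoint A ∧ A.IsBoundedFromBelow ∧
    A.essSpec = (fun x : ℝ => (x : ℂ)) '' Ici 0 ∧
    {x : ℝ | x < 0 ∧ (x : ℂ) ∈ A.spec}.Finite ∧
    ∀ x : ℝ, x < 0 → (x : ℂ) ∈ A.spec → (x : ℂ) ∈ A.normalEigenvalues := by
  have hbelow : ∀ y : A.domain, -‖T‖ ^ 2 * ‖(y : H)‖ ^ 2 ≤ (⟪A y, (y : H)⟫_ℂ).re := by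
    intro y
    refine le_trans ?_ (hT y)
    have := T.le_opNorm (y : H)
    have h2 : ‖T (y : H)‖ ^ 2 ≤ (‖T‖ * ‖(y : H)‖) ^ 2 := by gcongr
    nlinarith
  have hnot : ∀ r : ℝ, r < 0 → (r : ℂ) ∉ (fun x : ℝ => (x : ℂ)) '' Ici 0 := by
    rintro r hr ⟨x, hx, hxr⟩
    have : x = r := Complex.ofReal_injective hxr
    exact absurd hr (not_lt.2 (this ▸ hx))
  have hsa : IsSelfAdjoint A := by
    have hneg : -‖T‖ ^ 2 - 1 < 0 := by nlinarith [sq_nonneg ‖T‖]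
    -- The shift lies strictly below the lower bound `-‖T‖²` of the form, which makes `A` minus the
    -- shift injective; `hsurj` then gives surjectivity.
    refine isSelfAdjoint_of_surjective hA (-‖T‖ ^ 2 - 1) (hsurj _ (hnot _ hneg) fun y hy => ?_)
    have h1 := hbelow y
    rw [inner_re_eq_of_map_eq_smul y hy] at h1
    have h2 : ‖(y : H)‖ ^ 2 ≤ 0 := by linarith
    exact Subtype.ext (by simpa using le_antisymm h2 (sq_nonneg _))
  have hres : ∀ z : ℂ, z ∉ (fun x : ℝ => (x : ℂ)) '' Ici 0 → z ∈ A.spec →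
      ∃ y : A.domain, y ≠ 0 ∧ A y = z • (y : H) := by
    intro z hz hzs
    by_contra! hcon
    have hi : ∀ y : A.domain, A y = z • (y : H) → y = 0 := fun y hy => by
      by_contra h0
      exact hcon y h0 hy
    exact hzs (mem_resolvents_of_bijective hsa.isClosed hi (hsurj z hz hi))
  have hreal : ∀ z ∈ A.spec, z ∉ (fun x : ℝ => (x : ℂ)) '' Ici 0 → ∃ r : ℝ, r < 0 ∧ z = r := by
    intro z hzs hz
    obtain ⟨y, hy0, hy⟩ := hres z hz hzs
    have him : z.im = 0 := by
      by_contra h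
      exact hy0 (eq_zero_of_map_eq_smul_of_im_ne_zero hA h y hy)
    have hzr : z = (z.re : ℂ) := Complex.ext rfl (by simp [him])
    refine ⟨z.re, ?_, hzr⟩
    by_contra h
    exact hz ⟨z.re, not_lt.1 h, hzr.symm⟩
  have hfin : {x : ℝ | x < 0 ∧ (x : ℂ) ∈ A.spec}.Finite :=
    (finite_negative_eigenvalues hA T hT).subset fun r hr => ⟨hr.1, hres r (hnot r hr.1) hr.2⟩
  have hnormal : ∀ x : ℝ, x < 0 → (x : ℂ) ∈ A.spec → (x : ℂ) ∈ A.normalEigenvalues := by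
    intro x hx hxs
    obtain ⟨y, hy0, hy⟩ := hres x (hnot x hx) hxs
    refine ⟨fun h => hy0 ?_, finiteDimensional_eigenspaceAt T hT hx, ?_⟩
    · rw [← Submodule.mem_bot ℂ, ← h]
      exact mem_eigenspaceAt.2 hy
    -- The other negative spectral points form a finite, hence closed, set. Intersecting with the
    -- negative half-line also keeps the ball away from `[0, ∞)`.
    have hopen : IsOpen ({x : ℝ | x < 0 ∧ (x : ℂ) ∈ A.spec} \ {x})ᶜ :=
      (hfin.subset sdiff_subset).isClosed.isOpen_compl
    obtain ⟨ε, hε, hball⟩ := Metric.isOpen_iff.1 (hopen.inter isOpen_Iio) x ⟨by simp, hx⟩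
    refine ⟨ε, hε, fun w hw hd => ?_⟩
    have hwx : w.re ∈ Metric.ball x ε := by
      rw [Metric.mem_ball, Real.dist_eq]
      refine lt_of_le_of_lt ?_ hd
      rw [Complex.dist_eq]
      simpa using Complex.abs_re_le_norm (w - x)
    obtain ⟨h1, h2⟩ := hball hwx
    by_cases hw0 : w ∈ (fun x : ℝ => (x : ℂ)) '' Ici 0
    · obtain ⟨t, ht, rfl⟩ := hw0
      exact absurd (show t < 0 from h2) (not_lt.2 ht)
    · obtain ⟨r, hr, rfl⟩ := hreal w hw hw0
      by_contra hne
      exact h1 ⟨⟨hr, hw⟩, fun h => hne (congrArg _ (h : r = x))⟩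
  have hnn : ∀ r : ℝ, 0 ≤ r → (r : ℂ) ∈ A.spec := fun r hr => mem_spec_of_approx (happrox r hr)
  refine ⟨hsa, ⟨_, hbelow⟩, ?_, hfin, hnormal⟩
  ext z
  constructor
  · rintro ⟨hzs, hzn⟩
    by_contra hz
    obtain ⟨r, hr, rfl⟩ := hreal z hzs hz
    exact hzn (hnormal r hr hzs)
  · rintro ⟨r, hr, rfl⟩
    refine ⟨hnn r hr, ?_⟩
    rintro ⟨-, -, ε, hε, h⟩
    have hr' : (0 : ℝ) ≤ r := hr
    -- A second spectral point within `ε` of `r`: no point of `[0, ∞)` is isolated in the spectrum.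
    have h1 := h ((r + ε / 2 : ℝ) : ℂ) (hnn _ (by positivity)) (by
      rw [Complex.dist_of_im_eq (by simp), Real.dist_eq]
      rw [Complex.ofReal_re, Complex.ofReal_re, add_sub_cancel_left, abs_of_pos (half_pos hε)]
      exact half_lt_self hε)
    have h2 := Complex.ofReal_injective h1
    linarith

end FiniteRankBound

end LinearPMap

/-! ### Absolutely continuous functions with values in a normed space -/

/-- The variation sums of `f` are dominated term by term by those of `g`. This carries absolute
continuity over to vector-valued primitives, to conjugates and to translates. -/
theorem AbsolutelyContinuousOnInterval.of_dist_le {X Y : Type*} [PseudoMetricSpace X]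
    [PseudoMetricSpace Y] {f : ℝ → X} {g : ℝ → Y} {a b : ℝ}
    (hg : AbsolutelyContinuousOnInterval g a b)
    (h : ∀ x ∈ uIcc a b, ∀ y ∈ uIcc a b, dist (f x) (f y) ≤ dist (g x) (g y)) :
    AbsolutelyContinuousOnInterval f a b := by
  rw [absolutelyContinuousOnInterval_iff] at hg ⊢
  intro ε hε
  obtain ⟨δ, hδ, hE⟩ := hg ε hε
  refine ⟨δ, hδ, fun E hEd hEδ => lt_of_le_of_lt ?_ (hE E hEd hEδ)⟩
  exact Finset.sum_le_sum fun i hi => h _ (hEd.1 i hi).1 _ (hEd.1 i hi).2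

theorem IntervalIntegrable.absolutelyContinuousOnInterval_integral {F : Type*}
    [NormedAddCommGroup F] [NormedSpace ℝ F] {f : ℝ → F} {a b c : ℝ}
    (h : IntervalIntegrable f volume a b) (hc : c ∈ uIcc a b) :
    AbsolutelyContinuousOnInterval (fun x => ∫ t in c..x, f t) a b := by
  refine (h.norm.absolutelyContinuousOnInterval_intervalIntegral hc).of_dist_le
    fun x hx y hy => ?_
  have hi : ∀ x ∈ uIcc a b, IntervalIntegrable f volume c x := fun x hx =>
    h.mono_set (uIcc_subset_uIcc hc hx)
  rw [dist_eq_norm, dist_eq_norm, intervalIntegral.integral_interval_sub_left (hi x hx) (hi y hy),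
    intervalIntegral.integral_interval_sub_left (hi x hx).norm (hi y hy).norm, Real.norm_eq_abs]
  exact intervalIntegral.norm_integral_le_abs_integral_norm

/-- The difference of `f` and the primitive of `f'` is absolutely continuous with derivative zero
almost everywhere, hence constant. Only the open interval matters in `hd`, since edge functions have
just one-sided derivatives at the ends. -/
theorem AbsolutelyContinuousOnInterval.integral_eq_sub {F : Type*}
    [NormedAddCommGroup F] [NormedSpace ℝ F] [CompleteSpace F] {f f' : ℝ → F} {a b : ℝ}
    (hf : AbsolutelyContinuousOnInterval f a b) (hab : a ≤ b)
    (hd : ∀ᵐ x, x ∈ Ioo a b → HasDerivAt f (f' x) x) (hi : IntervalIntegrable f' volume a b) :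
    ∫ x in a..b, f' x = f b - f a := by
  have hg := hf.sub (hi.absolutelyContinuousOnInterval_integral (c := a) left_mem_uIcc)
  have h0 : ∀ᵐ x, x ∈ uIcc a b → HasDerivAt (f - fun x => ∫ t in a..x, f' t) 0 x := by
    have ha : ∀ᵐ x : ℝ, x ≠ a := by simp [ae_iff, measure_singleton]
    have hb : ∀ᵐ x : ℝ, x ≠ b := by simp [ae_iff, measure_singleton]
    filter_upwards [hd, hi.ae_hasDerivAt_integral, ha, hb] with x h1 h2 h3 h4 hx
    rw [← sub_self (f' x)]
    have hx' := hx
    rw [uIcc_of_le hab] at hx'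
    exact (h1 ⟨lt_of_le_of_ne hx'.1 h3.symm, lt_of_le_of_ne hx'.2 h4⟩).sub
      (h2 hx a left_mem_uIcc)
  obtain ⟨C, hC⟩ := hg.const_of_ae_hasDerivAt_zero h0
  have h1 := (hC a left_mem_uIcc).trans (hC b right_mem_uIcc).symm
  simp only [Pi.sub_apply, intervalIntegral.integral_same, sub_zero] at h1
  rw [h1]
  abel

theorem absolutelyContinuousOnInterval_of_hasDerivWithinAt {F : Type*}
    [NormedAddCommGroup F] [NormedSpace ℝ F] {f f' : ℝ → F} {a b : ℝ}
    (hd : ∀ x ∈ uIcc a b, HasDerivWithinAt f (f' x) (uIcc a b) x)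
    (hc : ContinuousOn f' (uIcc a b)) : AbsolutelyContinuousOnInterval f a b := by
  obtain ⟨C, hC⟩ := isCompact_uIcc.exists_bound_of_continuousOn hc
  have h : LipschitzOnWith C.toNNReal f (uIcc a b) := by
    refine (convex_uIcc a b).lipschitzOnWith_of_nnnorm_hasDerivWithin_le hd fun x hx => ?_
    rw [← NNReal.coe_le_coe, coe_nnnorm]
    exact (hC x hx).trans (Real.le_coe_toNNReal C)
  exact h.absolutelyContinuousOnInterval

/-! ### `H²` functions on an interval: Green's formula and decay at infinity -/

namespace LeadGraph

theorem IsH2Rep.continuousOn {J : Set ℝ} {f u u' u'' : ℝ → ℂ} (h : IsH2Rep J f u u' u'') :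
    ContinuousOn u J := fun x hx => (h.deriv_one x hx).continuousWithinAt

theorem IsH2Rep.absolutelyContinuous_deriv {J : Set ℝ} {f u u' u'' : ℝ → ℂ}
    (h : IsH2Rep J f u u' u'') {a b : ℝ} (ha : 0 ≤ a) (hab : a ≤ b) (hJ : Icc 0 b ⊆ J) :
    AbsolutelyContinuousOnInterval u' a b := by
  refine (h.abs_cont b (hJ ⟨ha.trans hab, le_rfl⟩)).mono ?_
  rw [uIcc_of_le hab, uIcc_of_le (ha.trans hab)]
  exact Icc_subset_Icc_left ha

theorem IsH2Rep.continuousOn_deriv {J : Set ℝ} {f u u' u'' : ℝ → ℂ}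
    (h : IsH2Rep J f u u' u'') {a b : ℝ} (ha : 0 ≤ a) (hab : a ≤ b) (hJ : Icc 0 b ⊆ J) :
    ContinuousOn u' (Icc a b) := by
  have := (h.absolutelyContinuous_deriv ha hab hJ).continuousOn
  rwa [uIcc_of_le hab] at this

theorem IsH2Rep.absolutelyContinuous {J : Set ℝ} {f u u' u'' : ℝ → ℂ}
    (h : IsH2Rep J f u u' u'') {a b : ℝ} (ha : 0 ≤ a) (hab : a ≤ b) (hJ : Icc 0 b ⊆ J) :
    AbsolutelyContinuousOnInterval u a b := by
  have hs : uIcc a b ⊆ J := by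
    rw [uIcc_of_le hab]
    exact (Icc_subset_Icc_left ha).trans hJ
  refine absolutelyContinuousOnInterval_of_hasDerivWithinAt
    (fun x hx => (h.deriv_one x (hs hx)).mono hs) ?_
  rw [uIcc_of_le hab]
  exact h.continuousOn_deriv ha hab hJ

theorem IsH2Rep.ae_hasDerivAt {J : Set ℝ} {f u u' u'' : ℝ → ℂ} (h : IsH2Rep J f u u' u'')
    (hm : MeasurableSet J) {a b : ℝ} (ha : 0 ≤ a) (hJ : Icc 0 b ⊆ J) :
    ∀ᵐ x, x ∈ Ioo a b → HasDerivAt u' (u'' x) x := by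
  filter_upwards [(ae_restrict_iff' hm).1 h.deriv_two] with x hx hxab
  have hs : Ioo a b ⊆ J := fun t ht => hJ ⟨ha.trans ht.1.le, ht.2.le⟩
  exact (hx (hs hxab)).hasDerivAt (mem_of_superset (Ioo_mem_nhds hxab.1 hxab.2) hs)

theorem IsH2Rep.hasDerivAt {J : Set ℝ} {f u u' u'' : ℝ → ℂ} (h : IsH2Rep J f u u' u'')
    {a b x : ℝ} (ha : 0 ≤ a) (hJ : Icc 0 b ⊆ J) (hx : x ∈ Ioo a b) : HasDerivAt u (u' x) x := by
  have hs : Ioo a b ⊆ J := fun t ht => hJ ⟨ha.trans ht.1.le, ht.2.le⟩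
  exact (h.deriv_one x (hs hx)).hasDerivAt (mem_of_superset (Ioo_mem_nhds hx.1 hx.2) hs)

theorem MemLp.intervalIntegrable_of_subset {J : Set ℝ} {g : ℝ → ℂ}
    (h : MemLp g 2 (volume.restrict J)) {a b : ℝ} (hab : a ≤ b) (hJ : Icc a b ⊆ J) :
    IntervalIntegrable g volume a b := by
  have h1 : MemLp g 2 (volume.restrict (Icc a b)) :=
    h.mono_measure (Measure.restrict_mono hJ le_rfl)
  rw [intervalIntegrable_iff_integrableOn_Icc_of_le hab]
  exact h1.integrable one_le_two

/-- Green's formula on an interval `[a, b]`. -/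
theorem IsH2Rep.integral_conj_mul {J : Set ℝ} {f g u u' u'' v v' v'' : ℝ → ℂ}
    (h : IsH2Rep J f u u' u'') (k : IsH2Rep J g v v' v'') (hm : MeasurableSet J) {a b : ℝ}
    (ha : 0 ≤ a) (hab : a ≤ b) (hJ : Icc 0 b ⊆ J) :
    ∫ x in a..b, conj (u'' x) * v x =
      conj (u' b) * v b - conj (u' a) * v a - ∫ x in a..b, conj (u' x) * v' x := by
  have hs : Icc a b ⊆ J := (Icc_subset_Icc_left ha).trans hJ
  have hcu : AbsolutelyContinuousOnInterval (fun x => conj (u' x)) a b :=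
    (h.absolutelyContinuous_deriv ha hab hJ).of_dist_le fun x _ y _ => by
      rw [dist_eq_norm, dist_eq_norm, ← map_sub, RCLike.norm_conj]
  have hac := hcu.fun_smul (k.absolutelyContinuous ha hab hJ)
  have hu2 : IntervalIntegrable (fun x => conj (u'' x)) volume a b := by
    have := MemLp.intervalIntegrable_of_subset h.memLp_two hab hs
    refine this.norm.mono_fun (RCLike.continuous_conj.comp_aestronglyMeasurable this.aestronglyMeasurable_restrict_uIoc) ?_
    exact Eventually.of_forall fun x => by simp
  have hi1 : IntervalIntegrable (fun x => conj (u'' x) * v x) volume a b := by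
    refine hu2.mul_continuousOn ?_
    rw [uIcc_of_le hab]
    exact k.continuousOn.mono hs
  have hi2 : IntervalIntegrable (fun x => conj (u' x) * v' x) volume a b := by
    refine ContinuousOn.intervalIntegrable ?_
    rw [uIcc_of_le hab]
    exact (RCLike.continuous_conj.comp_continuousOn (h.continuousOn_deriv ha hab hJ)).mul
      (k.continuousOn_deriv ha hab hJ)
  have := hac.integral_eq_sub (f' := fun x => conj (u'' x) * v x + conj (u' x) * v' x) hab (by
    filter_upwards [h.ae_hasDerivAt hm ha hJ] with x hx hxab
    exact (hx hxab).star.mul (k.hasDerivAt ha hJ hxab)) (hi1.add hi2)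
  rw [intervalIntegral.integral_add hi1 hi2] at this
  simp only [smul_eq_mul] at this
  rw [← this]
  ring

/-- The values of `u` and `u'` at the left end of an interval, in terms of the integrals of `u` and
`u''` against a test function that vanishes to second order at the right end. -/
theorem IsH2Rep.integral_test {J : Set ℝ} {f u u' u'' : ℝ → ℂ}
    (h : IsH2Rep J f u u' u'') (hm : MeasurableSet J) {a b : ℝ}
    (ha : 0 ≤ a) (hab : a ≤ b) (hJ : Icc 0 b ⊆ J) {φ φ' φ'' : ℝ → ℂ}
    (hφ : ∀ x, HasDerivAt φ (φ' x) x) (hφ' : ∀ x, HasDerivAt φ' (φ'' x) x)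
    (hφ'' : Continuous φ'') (h0 : φ b = 0) (h1 : φ' b = 0) :
    ∫ x in a..b, (u'' x * φ x - u x * φ'' x) = u a * φ' a - u' a * φ a := by
  have hs : Icc a b ⊆ J := (Icc_subset_Icc_left ha).trans hJ
  have c0 : Continuous φ := continuous_iff_continuousAt.2 fun x => (hφ x).continuousAt
  have c1 : Continuous φ' := continuous_iff_continuousAt.2 fun x => (hφ' x).continuousAt
  have hac := ((h.absolutelyContinuous_deriv ha hab hJ).fun_smul
    (absolutelyContinuousOnInterval_of_hasDerivWithinAt
      (fun x _ => (hφ x).hasDerivWithinAt) c1.continuousOn)).sub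
    ((h.absolutelyContinuous ha hab hJ).fun_smul
    (absolutelyContinuousOnInterval_of_hasDerivWithinAt
      (fun x _ => (hφ' x).hasDerivWithinAt) hφ''.continuousOn))
  have hi1 : IntervalIntegrable (fun x => u'' x * φ x) volume a b :=
    (MemLp.intervalIntegrable_of_subset h.memLp_two hab hs).mul_continuousOn c0.continuousOn
  have hi2 : IntervalIntegrable (fun x => u x * φ'' x) volume a b := by
    refine ContinuousOn.intervalIntegrable ?_
    rw [uIcc_of_le hab]
    exact (h.continuousOn.mono hs).mul hφ''.continuousOn
  have := hac.integral_eq_sub (f' := fun x => u'' x * φ x - u x * φ'' x) hab (by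
    filter_upwards [h.ae_hasDerivAt hm ha hJ] with x hx hxab
    exact (((hx hxab).mul (hφ x)).sub ((h.hasDerivAt ha hJ hxab).mul (hφ' x))).congr_deriv
      (by ring)) (hi1.sub hi2)
  rw [this]
  simp [h0, h1]

/-- The integrals of `‖g‖²` over `[x, x + 1]` are differences of two convergent quantities with the
same limit, so they tend to zero; on an interval of length one they control those of `‖g‖`. -/
theorem tendsto_integral_add_one_of_memLp {g : ℝ → ℂ} (hg : MemLp g 2 (volume.restrict (Ici 0))) :
    Tendsto (fun x => ∫ t in x..x + 1, ‖g t‖) atTop (𝓝 0) := by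
  have hsq : IntegrableOn (fun t => ‖g t‖ ^ 2) (Ioi 0) :=
    (hg.norm.integrable_sq).mono_measure (Measure.restrict_mono Ioi_subset_Ici_self le_rfl)
  have hI : ∀ {a b : ℝ}, 0 ≤ a → a ≤ b →
      IntervalIntegrable (fun t => ‖g t‖ ^ 2) volume a b := fun ha hab => by
    rw [intervalIntegrable_iff_integrableOn_Ioc_of_le hab]
    exact hsq.mono_set fun t ht => ha.trans_lt ht.1
  have ht := intervalIntegral_tendsto_integral_Ioi 0 hsq tendsto_id
  have ht1 := intervalIntegral_tendsto_integral_Ioi 0 hsq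
    (tendsto_id.atTop_add (tendsto_const_nhds (x := (1 : ℝ))))
  have hd : Tendsto (fun x : ℝ => ∫ t in x..x + 1, ‖g t‖ ^ 2) atTop (𝓝 0) := by
    have := ht1.sub ht
    rw [sub_self] at this
    refine this.congr' ?_
    filter_upwards [eventually_ge_atTop 0] with x hx
    exact intervalIntegral.integral_interval_sub_left (hI le_rfl (by simp; linarith)) (hI le_rfl hx)
  rw [Metric.tendsto_atTop]
  intro ε hε
  obtain ⟨N, hN⟩ := Metric.tendsto_atTop.1 hd (ε ^ 2) (by positivity)
  refine ⟨max N 0, fun x hx => ?_⟩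
  have hx0 : 0 ≤ x := (le_max_right _ _).trans hx
  have h1 := hN x ((le_max_left _ _).trans hx)
  rw [Real.dist_eq, sub_zero] at h1 ⊢
  have hx1 : x ≤ x + 1 := by linarith
  have hgi : IntervalIntegrable (fun t => ‖g t‖) volume x (x + 1) :=
    (MemLp.intervalIntegrable_of_subset hg hx1 fun t ht => hx0.trans ht.1).norm
  -- The weighted arithmetic-geometric inequality `s ≤ ε / 2 + s² / (2 ε)` takes the place of
  -- Cauchy-Schwarz.
  have h2 : ∫ t in x..x + 1, ‖g t‖ ≤ ∫ t in x..x + 1, (ε / 2 + ‖g t‖ ^ 2 / (2 * ε)) := by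
    refine intervalIntegral.integral_mono_on hx1 hgi
      (intervalIntegrable_const.add ((hI hx0 hx1).div_const _)) fun t _ => ?_
    rw [div_add_div _ _ two_ne_zero (by positivity), le_div_iff₀ (by positivity)]
    nlinarith [sq_nonneg (ε - ‖g t‖)]
  rw [intervalIntegral.integral_add intervalIntegrable_const ((hI hx0 hx1).div_const _),
    intervalIntegral.integral_const, intervalIntegral.integral_div] at h2
  have h3 : (∫ t in x..x + 1, ‖g t‖ ^ 2) / (2 * ε) < ε / 2 := by
    rw [div_lt_iff₀ (by positivity)]
    calc _ ≤ _ := le_abs_self _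
      _ < _ := h1
      _ = _ := by ring
  have h4 : 0 ≤ ∫ t in x..x + 1, ‖g t‖ :=
    intervalIntegral.integral_nonneg hx1 fun t _ => norm_nonneg _
  rw [abs_of_nonneg h4]
  simp only [add_sub_cancel_left, one_smul] at h2
  linarith

/-- The test function is `(1 - s)² (α + β s)` with `s = t - x`: at `s = 0` it has value `α` and
slope `β - 2 α`, and it vanishes to second order at `s = 1`. The choice `α = 0`, `β = 1` isolates `u
x`, and `α = 1`, `β = 2` isolates `u' x`. The constants `3` and `20` are crude bounds for the test
function and its second derivative. -/
theorem IsH2Rep.norm_test_le {f u u' u'' : ℝ → ℂ} (h : IsH2Rep (Ici 0) f u u' u'')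
    {x : ℝ} (hx : 0 ≤ x) {α β : ℝ} (hα : α ∈ Icc (0 : ℝ) 1) (hβ : β ∈ Icc (0 : ℝ) 2) :
    ‖u x * (β - 2 * α) - u' x * α‖ ≤
      3 * (∫ t in x..x + 1, ‖u'' t‖) + 20 * ∫ t in x..x + 1, ‖u t‖ := by
  have hx1 : x ≤ x + 1 := by linarith
  have hJ : Icc 0 (x + 1) ⊆ Ici 0 := fun t ht => ht.1
  have hs : Icc x (x + 1) ⊆ Ici 0 := fun t ht => hx.trans ht.1
  have key := h.integral_test measurableSet_Ici hx hx1 hJ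
    (φ := fun t => (1 - ((t : ℂ) - x)) ^ 2 * (α + β * ((t : ℂ) - x)))
    (φ' := fun t => -2 * (1 - ((t : ℂ) - x)) * (α + β * ((t : ℂ) - x))
      + (1 - ((t : ℂ) - x)) ^ 2 * β)
    (φ'' := fun t => 2 * (α + β * ((t : ℂ) - x)) - 4 * (1 - ((t : ℂ) - x)) * β)
    (fun t => by
      have h0 : HasDerivAt (fun t : ℝ => (t : ℂ) - x) 1 t :=
        (Complex.ofRealCLM.hasDerivAt (x := t)).sub_const _
      refine (((h0.const_sub 1).pow 2).mul
        ((h0.const_mul (β : ℂ)).const_add (α : ℂ))).congr_deriv ?_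
      simp only [Pi.pow_apply]
      push_cast
      ring)
    (fun t => by
      have h0 : HasDerivAt (fun t : ℝ => (t : ℂ) - x) 1 t :=
        (Complex.ofRealCLM.hasDerivAt (x := t)).sub_const _
      refine ((((h0.const_sub 1).const_mul (-2)).mul
        ((h0.const_mul (β : ℂ)).const_add (α : ℂ))).add
        (((h0.const_sub 1).pow 2).mul_const (β : ℂ))).congr_deriv ?_
      push_cast
      ring)
    (by fun_prop) (by push_cast; ring) (by push_cast; ring)
  have key' : u x * (β - 2 * α) - u' x * α = ∫ t in x..x + 1,
      (u'' t * ((1 - ((t : ℂ) - x)) ^ 2 * (α + β * ((t : ℂ) - x)))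
        - u t * (2 * (α + β * ((t : ℂ) - x)) - 4 * (1 - ((t : ℂ) - x)) * β)) := by
    rw [key]
    ring
  have hu2 := (MemLp.intervalIntegrable_of_subset h.memLp_two hx1 hs).norm
  have hu : IntervalIntegrable (fun t => ‖u t‖) volume x (x + 1) := by
    refine ContinuousOn.intervalIntegrable ?_
    rw [uIcc_of_le hx1]
    exact (h.continuousOn.mono hs).norm
  rw [key', ← intervalIntegral.integral_const_mul, ← intervalIntegral.integral_const_mul,
    ← intervalIntegral.integral_add (hu2.const_mul 3) (hu.const_mul 20)]
  refine intervalIntegral.norm_integral_le_of_norm_le hx1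
    (ae_of_all _ fun t ht => ?_) ((hu2.const_mul 3).add (hu.const_mul 20))
  have hs0 : 0 ≤ t - x := by linarith [ht.1]
  have hs1 : t - x ≤ 1 := by linarith [ht.2]
  have hl : |α + β * (t - x)| ≤ 3 := by
    rw [abs_le]
    constructor <;> nlinarith [hα.1, hα.2, hβ.1, hβ.2]
  have hb1 : ‖(1 - ((t : ℂ) - x)) ^ 2 * (α + β * ((t : ℂ) - x))‖ ≤ 3 := by
    have : (1 - ((t : ℂ) - x)) ^ 2 * (α + β * ((t : ℂ) - x)) =
      (((1 - (t - x)) ^ 2 * (α + β * (t - x)) : ℝ) : ℂ) := by push_cast; ring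
    rw [this, Complex.norm_real, Real.norm_eq_abs, abs_mul, abs_of_nonneg (sq_nonneg _)]
    have : (1 - (t - x)) ^ 2 ≤ 1 := by nlinarith
    nlinarith [abs_nonneg (α + β * (t - x)), sq_nonneg (1 - (t - x))]
  have hb2 : ‖2 * (α + β * ((t : ℂ) - x)) - 4 * (1 - ((t : ℂ) - x)) * β‖ ≤ 20 := by
    have : 2 * (α + β * ((t : ℂ) - x)) - 4 * (1 - ((t : ℂ) - x)) * β =
      ((2 * (α + β * (t - x)) - 4 * (1 - (t - x)) * β : ℝ) : ℂ) := by push_cast; ring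
    rw [this, Complex.norm_real, Real.norm_eq_abs, abs_le]
    constructor <;> nlinarith [hα.1, hα.2, hβ.1, hβ.2]
  calc _ ≤ ‖u'' t‖ * 3 + ‖u t‖ * 20 := by
        refine (norm_sub_le _ _).trans ?_
        rw [norm_mul (u'' t), norm_mul (u t)]
        gcongr
    _ = _ := by ring

/-- Square integrability of `u` and `u''` alone is enough; this removes the boundary term at
infinity in Green's formula on the lead. -/
theorem IsH2Rep.tendsto_zero {f u u' u'' : ℝ → ℂ} (h : IsH2Rep (Ici 0) f u u' u'')
    (hf : MemLp f 2 (volume.restrict (Ici 0))) :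
    Tendsto u atTop (𝓝 0) ∧ Tendsto u' atTop (𝓝 0) := by
  have hu : MemLp u 2 (volume.restrict (Ici 0)) := (memLp_congr_ae h.ae_eq).1 hf
  have hlim : Tendsto (fun x => 3 * (∫ t in x..x + 1, ‖u'' t‖) + 20 * ∫ t in x..x + 1, ‖u t‖)
      atTop (𝓝 0) := by
    simpa using ((tendsto_integral_add_one_of_memLp h.memLp_two).const_mul 3).add
      ((tendsto_integral_add_one_of_memLp hu).const_mul 20)
  constructor
  · refine squeeze_zero_norm' ?_ hlim
    filter_upwards [eventually_ge_atTop 0] with x hx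
    simpa using h.norm_test_le hx (α := 0) (β := 1) (by simp) (by simp)
  · refine squeeze_zero_norm' ?_ hlim
    filter_upwards [eventually_ge_atTop 0] with x hx
    simpa using h.norm_test_le hx (α := 1) (β := 2) (by simp) (by simp)

end LeadGraph

/-! ### Lower bound for the form of an edge, and Green's formula in `L²` -/

namespace LeadGraph

/-- Expand the nonnegative integral of the squared deviation of `f` from its mean. -/
theorem sq_integral_le_mul_integral_sq {f : ℝ → ℝ} {a b : ℝ} (hab : a < b)
    (hf : ContinuousOn f (Icc a b)) :
    (∫ x in a..b, f x) ^ 2 ≤ (b - a) * ∫ x in a..b, f x ^ 2 := by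
  rw [← uIcc_of_le hab.le] at hf
  have hf2 : IntervalIntegrable (fun x => f x ^ 2) volume a b := (hf.pow 2).intervalIntegrable
  have hd : 0 < b - a := sub_pos.2 hab
  set S := ∫ x in a..b, f x
  have h1 : 0 ≤ ∫ x in a..b, (f x - S / (b - a)) ^ 2 :=
    intervalIntegral.integral_nonneg hab.le fun x _ => sq_nonneg _
  have h2 : ∫ x in a..b, (f x - S / (b - a)) ^ 2 =
      (∫ x in a..b, f x ^ 2) - 2 * (S / (b - a)) * S + (b - a) * (S / (b - a)) ^ 2 := by
    have e : ∀ x, (f x - S / (b - a)) ^ 2 =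
        f x ^ 2 - 2 * (S / (b - a)) * f x + (S / (b - a)) ^ 2 := fun x => by ring
    simp_rw [e]
    rw [intervalIntegral.integral_add
      (hf2.sub (hf.intervalIntegrable.const_mul _))
      intervalIntegrable_const, intervalIntegral.integral_sub hf2
      (hf.intervalIntegrable.const_mul _), intervalIntegral.integral_const_mul,
      intervalIntegral.integral_const, smul_eq_mul]
  rw [h2] at h1
  have h3 : (b - a) * (S / (b - a)) ^ 2 = S ^ 2 / (b - a) := by field_simp
  have h4 : 2 * (S / (b - a)) * S = 2 * (S ^ 2 / (b - a)) := by ring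
  rw [h3, h4] at h1
  have h5 : S ^ 2 / (b - a) ≤ ∫ x in a..b, f x ^ 2 := by linarith
  rw [div_le_iff₀ hd] at h5
  linarith

/-- A Sobolev inequality on an interval. -/
theorem norm_sq_le_of_hasDerivWithinAt {u u' : ℝ → ℂ} {a b : ℝ} (hab : a < b)
    (hu : ∀ x ∈ Icc a b, HasDerivWithinAt u (u' x) (Icc a b) x)
    (hc : ContinuousOn u' (Icc a b)) {x : ℝ} (hx : x ∈ Icc a b) :
    ‖u x‖ ^ 2 ≤ 2 / (b - a) ^ 2 * ‖∫ t in a..b, u t‖ ^ 2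
      + 2 * (b - a) * ∫ t in a..b, ‖u' t‖ ^ 2 := by
  have hd : 0 < b - a := sub_pos.2 hab
  have huc : ContinuousOn u (Icc a b) := fun t ht => (hu t ht).continuousWithinAt
  have hcn : ContinuousOn (fun t => ‖u' t‖) (Icc a b) := hc.norm
  set S := ∫ t in a..b, ‖u' t‖
  have hS0 : 0 ≤ S := intervalIntegral.integral_nonneg hab.le fun _ _ => norm_nonneg _
  have hdiff : ∀ t ∈ Icc a b, ∀ s ∈ Icc a b, t ≤ s → ‖u s - u t‖ ≤ S := by
    intro t ht s hs hts
    have hsub : Icc t s ⊆ Icc a b := Icc_subset_Icc ht.1 hs.2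
    have hint : ∫ r in t..s, u' r = u s - u t := by
      refine intervalIntegral.integral_eq_sub_of_hasDerivAt_of_le hts (huc.mono hsub)
        (fun r hr => (hu r (hsub (Ioo_subset_Icc_self hr))).hasDerivAt ?_)
        (ContinuousOn.intervalIntegrable (by rw [uIcc_of_le hts]; exact hc.mono hsub))
      exact Icc_mem_nhds (ht.1.trans_lt hr.1) (hr.2.trans_le hs.2)
    rw [← hint]
    refine (intervalIntegral.norm_integral_le_integral_norm hts).trans ?_
    refine intervalIntegral.integral_mono_interval ht.1 hts hs.2
      (Eventually.of_forall fun _ => norm_nonneg _) (ContinuousOn.intervalIntegrable ?_)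
    rwa [uIcc_of_le hab.le]
  have hdiff' : ∀ t ∈ Icc a b, ‖u x - u t‖ ≤ S := fun t ht => by
    rcases le_total t x with h | h
    · exact hdiff t ht x hx h
    · rw [norm_sub_rev]
      exact hdiff x hx t ht h
  have hui : IntervalIntegrable u volume a b :=
    ContinuousOn.intervalIntegrable (by rwa [uIcc_of_le hab.le])
  -- Since `u` oscillates by at most `S = ∫ ‖u'‖`, averaging over `t` bounds `‖u x‖` by the modulus
  -- of the mean plus `S`. Cauchy-Schwarz then turns `S²` into the kinetic energy.
  have h1 : ‖∫ t in a..b, (u x - u t)‖ ≤ S * (b - a) := by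
    have := intervalIntegral.norm_integral_le_of_norm_le_const (a := a) (b := b)
      (f := fun t => u x - u t) (C := S) fun t ht => by
        rw [uIoc_of_le hab.le] at ht
        exact hdiff' t (Ioc_subset_Icc_self ht)
    rwa [abs_of_pos hd] at this
  rw [intervalIntegral.integral_sub intervalIntegrable_const hui, intervalIntegral.integral_const]
    at h1
  have h2 : (b - a) * ‖u x‖ ≤ ‖∫ t in a..b, u t‖ + S * (b - a) := by
    have e : ‖(b - a) • u x‖ = (b - a) * ‖u x‖ := by
      rw [norm_smul, Real.norm_eq_abs, abs_of_pos hd]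
    rw [← e]
    have := norm_add_le ((b - a) • u x - ∫ t in a..b, u t) (∫ t in a..b, u t)
    rw [sub_add_cancel] at this
    linarith
  have h3 := sq_integral_le_mul_integral_sq hab hcn
  set m := ‖∫ t in a..b, u t‖
  have h4 : ‖u x‖ ≤ m / (b - a) + S := by
    rw [← sub_le_iff_le_add, le_div_iff₀ hd]
    linarith
  calc ‖u x‖ ^ 2 ≤ (m / (b - a) + S) ^ 2 := by gcongr
    _ ≤ 2 * (m / (b - a)) ^ 2 + 2 * S ^ 2 := by nlinarith [sq_nonneg (m / (b - a) - S)]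
    _ ≤ 2 * (m / (b - a)) ^ 2 + 2 * ((b - a) * ∫ t in a..b, ‖u' t‖ ^ 2) := by gcongr
    _ = _ := by rw [div_pow]; ring

/-- On an interval of length at most `1 / (2 ‖q‖₁)`, the form `∫ ‖u'‖² + q ‖u‖²` is bounded below
by a multiple of the square of the mean of `u`. -/
theorem neg_norm_sq_integral_le_form {q : ℝ → ℝ} {u u' : ℝ → ℂ} {a b Q : ℝ} (hab : a < b)
    (hq : IntervalIntegrable q volume a b) (hQ : ∫ x in a..b, |q x| ≤ Q) (hδ : 2 * (b - a) * Q ≤ 1)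
    (hu : ∀ x ∈ Icc a b, HasDerivWithinAt u (u' x) (Icc a b) x)
    (hc : ContinuousOn u' (Icc a b)) :
    -(2 * Q / (b - a) ^ 2 * ‖∫ t in a..b, u t‖ ^ 2) ≤
      ∫ t in a..b, (‖u' t‖ ^ 2 + q t * ‖u t‖ ^ 2) := by
  have huc : ContinuousOn u (Icc a b) := fun t ht => (hu t ht).continuousWithinAt
  set E := ∫ t in a..b, ‖u' t‖ ^ 2 with hE
  set m := ‖∫ t in a..b, u t‖
  set K := 2 / (b - a) ^ 2 * m ^ 2 + 2 * (b - a) * E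
  have hd : 0 < b - a := sub_pos.2 hab
  have hE0 : 0 ≤ E := intervalIntegral.integral_nonneg hab.le fun _ _ => sq_nonneg _
  have hK0 : 0 ≤ K := by positivity
  have hint1 : IntervalIntegrable (fun t => ‖u' t‖ ^ 2) volume a b :=
    ContinuousOn.intervalIntegrable (by rw [uIcc_of_le hab.le]; exact hc.norm.pow 2)
  have hint2 : IntervalIntegrable (fun t => q t * ‖u t‖ ^ 2) volume a b :=
    hq.mul_continuousOn (by rw [uIcc_of_le hab.le]; exact huc.norm.pow 2)
  rw [intervalIntegral.integral_add hint1 hint2, ← hE]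
  -- With `‖u‖²` replaced by its uniform bound `K`, the potential costs at most `Q K`, whose energy
  -- part is `2 (b - a) Q E ≤ E` by `hδ` and so is absorbed.
  have h1 : ∫ t in a..b, -(|q t| * K) ≤ ∫ t in a..b, q t * ‖u t‖ ^ 2 := by
    refine intervalIntegral.integral_mono_on hab.le (hq.abs.mul_const K).neg hint2 fun t ht => ?_
    have h2 : ‖u t‖ ^ 2 ≤ K := norm_sq_le_of_hasDerivWithinAt hab hu hc ht
    have h3 := neg_abs_le (q t)
    have h4 := abs_nonneg (q t)
    have h5 := sq_nonneg ‖u t‖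
    nlinarith
  rw [intervalIntegral.integral_neg, intervalIntegral.integral_mul_const] at h1
  have h2 : (∫ t in a..b, |q t|) * K ≤ Q * K := mul_le_mul_of_nonneg_right hQ hK0
  have h3 : Q * K = 2 * Q / (b - a) ^ 2 * m ^ 2 + 2 * (b - a) * Q * E := by
    simp only [K]
    ring
  have h4 : 2 * (b - a) * Q * E ≤ 1 * E := mul_le_mul_of_nonneg_right hδ hE0
  linarith

/-- The form of an edge is bounded below by a form of finite rank. -/
theorem exists_neg_sum_le_form {ℓ : ℝ} (hℓ : 0 < ℓ) {q : ℝ → ℝ}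
    (hq : MemLp q 2 (volume.restrict (Icc 0 ℓ))) :
    ∃ (n : ℕ) (c : ℝ) (a : ℕ → ℝ), (∀ i < n, 0 ≤ a i ∧ a i ≤ a (i + 1) ∧ a (i + 1) ≤ ℓ) ∧
      ∀ u u' : ℝ → ℂ,
      (∀ x ∈ Icc 0 ℓ, HasDerivWithinAt u (u' x) (Icc 0 ℓ) x) → ContinuousOn u' (Icc 0 ℓ) →
      -(∑ i ∈ Finset.range n, c ^ 2 * ‖∫ t in a i..a (i + 1), u t‖ ^ 2) ≤
        ∫ t in 0..ℓ, (‖u' t‖ ^ 2 + q t * ‖u t‖ ^ 2) := by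
  have hqi : IntervalIntegrable q volume 0 ℓ := by
    rw [intervalIntegrable_iff_integrableOn_Icc_of_le hℓ.le]
    exact hq.integrable one_le_two
  set Q := ∫ x in 0..ℓ, |q x|
  have hQ0 : 0 ≤ Q := intervalIntegral.integral_nonneg hℓ.le fun _ _ => abs_nonneg _
  -- With `n > 2 ℓ Q` equal pieces, each has length `ℓ / n` and satisfies the smallness condition `2
  -- (ℓ / n) Q ≤ 1`.
  obtain ⟨n, hn⟩ := exists_nat_gt (2 * ℓ * Q)
  have hn0 : (0 : ℝ) < n := lt_of_le_of_lt (by positivity) hn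
  have hstep : ∀ i : ℕ, ((i + 1 : ℕ) : ℝ) * (ℓ / n) - i * (ℓ / n) = ℓ / n := fun i => by
    push_cast
    ring
  have hpos : 0 < ℓ / n := by positivity
  have hend : (n : ℝ) * (ℓ / n) = ℓ := by field_simp
  have hmem : ∀ i < n, 0 ≤ (i : ℝ) * (ℓ / n) ∧ (i : ℝ) * (ℓ / n) < ((i + 1 : ℕ) : ℝ) * (ℓ / n) ∧
      ((i + 1 : ℕ) : ℝ) * (ℓ / n) ≤ ℓ := fun i hi => by
    refine ⟨by positivity, by linarith [hstep i], ?_⟩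
    conv_rhs => rw [← hend]
    exact mul_le_mul_of_nonneg_right (by exact_mod_cast hi) hpos.le
  refine ⟨n, √(2 * Q / (ℓ / n) ^ 2), fun i => i * (ℓ / n),
    fun i hi => ⟨(hmem i hi).1, (hmem i hi).2.1.le, (hmem i hi).2.2⟩, fun u u' hu hc => ?_⟩
  have huc : ContinuousOn u (Icc 0 ℓ) := fun t ht => (hu t ht).continuousWithinAt
  have hint : IntervalIntegrable (fun t => ‖u' t‖ ^ 2 + q t * ‖u t‖ ^ 2) volume 0 ℓ := by
    rw [← uIcc_of_le hℓ.le] at hc huc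
    exact (hc.norm.pow 2).intervalIntegrable.add (hqi.mul_continuousOn (huc.norm.pow 2))
  have hsub : ∀ i < n, Icc ((i : ℝ) * (ℓ / n)) (((i + 1 : ℕ) : ℝ) * (ℓ / n)) ⊆ Icc 0 ℓ :=
    fun i hi => Icc_subset_Icc (hmem i hi).1 (hmem i hi).2.2
  have hsub' : ∀ i < n, uIcc ((i : ℝ) * (ℓ / n)) (((i + 1 : ℕ) : ℝ) * (ℓ / n)) ⊆ uIcc 0 ℓ :=
    fun i hi => by
      rw [uIcc_of_le hℓ.le, uIcc_of_le (hmem i hi).2.1.le]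
      exact hsub i hi
  have hsum := intervalIntegral.sum_integral_adjacent_intervals (μ := volume)
    (a := fun i : ℕ => (i : ℝ) * (ℓ / n)) (n := n) (f := fun t => ‖u' t‖ ^ 2 + q t * ‖u t‖ ^ 2)
    fun k hk => hint.mono_set (hsub' k hk)
  simp only [Nat.cast_zero, zero_mul, hend] at hsum
  rw [← hsum, ← Finset.sum_neg_distrib, Real.sq_sqrt (by positivity)]
  refine Finset.sum_le_sum fun i hi => ?_
  have hi' := Finset.mem_range.1 hi
  have := neg_norm_sq_integral_le_form (q := q) (u := u) (u' := u') (Q := Q) (hmem i hi').2.1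
    (hqi.mono_set (hsub' i hi')) ?_ ?_
    (fun x hx => (hu x (hsub i hi' hx)).mono (hsub i hi')) (hc.mono (hsub i hi'))
  · rwa [hstep] at this
  · exact intervalIntegral.integral_mono_interval (hmem i hi').1 (hmem i hi').2.1.le (hmem i hi').2.2
      (Eventually.of_forall fun _ => abs_nonneg _) hqi.abs
  · rw [hstep, mul_div_assoc', div_mul_eq_mul_div, div_le_one hn0]
    exact hn.le

/-- The boundary terms in Green's formula on an edge. -/
def boundaryTerm {E : Type*} (ℓ : ℝ) (u' v : ℝ → ℂ) : Option E → ℂ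
  | none => conj (u' 0) * v 0
  | some _ => conj (u' 0) * v 0 - conj (u' ℓ) * v ℓ

theorem inner_eq_integral {J : Set ℝ} (w g : Lp ℂ 2 (volume.restrict J)) {w₁ g₁ : ℝ → ℂ}
    (hw : w =ᵐ[volume.restrict J] w₁) (hg : g =ᵐ[volume.restrict J] g₁) :
    ⟪w, g⟫_ℂ = ∫ x in J, conj (w₁ x) * g₁ x := by
  rw [L2.inner_def]
  refine integral_congr_ae ?_
  filter_upwards [hw, hg] with x h1 h2
  rw [h1, h2, RCLike.inner_apply, mul_comm]

theorem integrable_conj_mul {J : Set ℝ} (w g : Lp ℂ 2 (volume.restrict J)) {w₁ g₁ : ℝ → ℂ}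
    (hw : w =ᵐ[volume.restrict J] w₁) (hg : g =ᵐ[volume.restrict J] g₁) :
    IntegrableOn (fun x => conj (w₁ x) * g₁ x) J := by
  refine (L2.integrable_inner (𝕜 := ℂ) w g).congr ?_
  filter_upwards [hw, hg] with x h1 h2
  rw [h1, h2, RCLike.inner_apply, mul_comm]

/-- Green's formula on the lead. -/
theorem tendsto_integral_lead {f g w : Lp ℂ 2 (volume.restrict (Ici (0 : ℝ)))}
    {u u' u'' v v' v'' : ℝ → ℂ} (h : IsH2Rep (Ici 0) f u u' u'') (k : IsH2Rep (Ici 0) g v v' v'')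
    (hw : w =ᵐ[volume.restrict (Ici 0)] fun x => -u'' x) :
    Tendsto (fun R : ℝ => ∫ x in 0..R, conj (u' x) * v' x) atTop
      (𝓝 (⟪w, g⟫_ℂ - conj (u' 0) * v 0)) := by
  rw [inner_eq_integral w g hw k.ae_eq, integral_Ici_eq_integral_Ioi]
  have hi := integrable_conj_mul w g hw k.ae_eq
  have h1 := intervalIntegral_tendsto_integral_Ioi 0
    (hi.mono_set Ioi_subset_Ici_self) tendsto_id
  -- Only the boundary term at `R` has to vanish. Working with the limit of truncated integrals
  -- avoids proving that `conj u' * v'` is integrable on the half-line.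
  have hu := (h.tendsto_zero (Lp.memLp f)).2
  have hv := (k.tendsto_zero (Lp.memLp g)).1
  have h2 : Tendsto (fun R => conj (u' R) * v R) atTop (𝓝 0) := by
    simpa using ((RCLike.continuous_conj (K := ℂ)).tendsto' 0 0 (by simp) |>.comp hu).mul hv
  have h3 := (h1.add h2).sub_const (conj (u' 0) * v 0)
  rw [add_zero] at h3
  refine h3.congr' ?_
  filter_upwards [eventually_ge_atTop 0] with R hR
  have := h.integral_conj_mul k measurableSet_Ici le_rfl hR (fun t ht => ht.1)
  simp only [id, map_neg, neg_mul, intervalIntegral.integral_neg]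
  rw [this]
  ring

/-- Green's formula on an edge of finite length. -/
theorem inner_sub_boundary {ℓ : ℝ} (hℓ : 0 < ℓ) {q : ℝ → ℝ}
    (hq : MemLp q 2 (volume.restrict (Icc 0 ℓ))) {f g w : Lp ℂ 2 (volume.restrict (Icc 0 ℓ))}
    {u u' u'' v v' v'' : ℝ → ℂ} (h : IsH2Rep (Icc 0 ℓ) f u u' u'')
    (k : IsH2Rep (Icc 0 ℓ) g v v' v'')
    (hw : w =ᵐ[volume.restrict (Icc 0 ℓ)] fun x => -u'' x + (q x : ℂ) * u x) :
    ⟪w, g⟫_ℂ - (conj (u' 0) * v 0 - conj (u' ℓ) * v ℓ) =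
      ∫ x in 0..ℓ, (conj (u' x) * v' x + q x * (conj (u x) * v x)) := by
  rw [inner_eq_integral w g hw k.ae_eq, integral_Icc_eq_integral_Ioc,
    ← intervalIntegral.integral_of_le hℓ.le]
  have hu := h.continuousOn
  have hv := k.continuousOn
  have hu' := h.continuousOn_deriv le_rfl hℓ.le subset_rfl
  have hv' := k.continuousOn_deriv le_rfl hℓ.le subset_rfl
  have hi0 := (intervalIntegrable_iff_integrableOn_Icc_of_le hℓ.le).2
    (integrable_conj_mul w g hw k.ae_eq)
  have hi1 : IntervalIntegrable (fun x => (q x : ℂ) * (conj (u x) * v x)) volume 0 ℓ := by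
    refine IntervalIntegrable.mul_continuousOn ?_ ?_
    · rw [intervalIntegrable_iff_integrableOn_Icc_of_le hℓ.le]
      exact (hq.integrable one_le_two).ofReal
    · rw [uIcc_of_le hℓ.le]
      exact (RCLike.continuous_conj.comp_continuousOn hu).mul hv
  have hi2 : IntervalIntegrable (fun x => conj (u' x) * v' x) volume 0 ℓ := by
    refine ContinuousOn.intervalIntegrable ?_
    rw [uIcc_of_le hℓ.le]
    exact (RCLike.continuous_conj.comp_continuousOn hu').mul hv'
  have key := h.integral_conj_mul k measurableSet_Icc le_rfl hℓ.le subset_rfl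
  have e : ∀ x, conj (u'' x) * v x =
      q x * (conj (u x) * v x) - conj (-u'' x + (q x : ℂ) * u x) * v x := fun x => by
    simp only [map_add, map_neg, map_mul, Complex.conj_ofReal]
    ring
  simp_rw [e] at key
  rw [intervalIntegral.integral_sub hi1 hi0] at key
  rw [intervalIntegral.integral_add hi2 hi1]
  linear_combination -key

end LeadGraph

/-! ### Symmetry and the form bound on the graph -/

namespace LeadGraph

section Form

/-- After the boundary terms are removed, both sides are the sesquilinear form of the edge, which is
Hermitian because `q` is real. -/
theorem green_symm_some {ℓ : ℝ} (hℓ : 0 < ℓ) {q : ℝ → ℝ}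
    (hq : MemLp q 2 (volume.restrict (Icc 0 ℓ))) {f g w t : Lp ℂ 2 (volume.restrict (Icc 0 ℓ))}
    {u u' u'' v v' v'' : ℝ → ℂ} (h : IsH2Rep (Icc 0 ℓ) f u u' u'')
    (k : IsH2Rep (Icc 0 ℓ) g v v' v'')
    (hw : w =ᵐ[volume.restrict (Icc 0 ℓ)] fun x => -u'' x + (q x : ℂ) * u x)
    (ht : t =ᵐ[volume.restrict (Icc 0 ℓ)] fun x => -v'' x + (q x : ℂ) * v x) :
    ⟪w, g⟫_ℂ - (conj (u' 0) * v 0 - conj (u' ℓ) * v ℓ) =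
      conj (⟪t, f⟫_ℂ - (conj (v' 0) * u 0 - conj (v' ℓ) * u ℓ)) := by
  rw [inner_sub_boundary hℓ hq h k hw, inner_sub_boundary hℓ hq k h ht,
    intervalIntegral.integral_of_le hℓ.le, intervalIntegral.integral_of_le hℓ.le, ← integral_conj]
  refine integral_congr_ae (Eventually.of_forall fun x => ?_)
  simp only [map_add, map_mul, Complex.conj_conj, Complex.conj_ofReal]
  ring

theorem green_symm_none {f g w t : Lp ℂ 2 (volume.restrict (Ici (0 : ℝ)))}
    {u u' u'' v v' v'' : ℝ → ℂ} (h : IsH2Rep (Ici 0) f u u' u'') (k : IsH2Rep (Ici 0) g v v' v'')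
    (hw : w =ᵐ[volume.restrict (Ici 0)] fun x => -u'' x)
    (ht : t =ᵐ[volume.restrict (Ici 0)] fun x => -v'' x) :
    ⟪w, g⟫_ℂ - conj (u' 0) * v 0 = conj (⟪t, f⟫_ℂ - conj (v' 0) * u 0) := by
  refine tendsto_nhds_unique (tendsto_integral_lead h k hw) ?_
  refine ((RCLike.continuous_conj (K := ℂ)).continuousAt.tendsto.comp
    (tendsto_integral_lead k h ht)).congr' ?_
  filter_upwards [eventually_ge_atTop 0] with R hR
  simp only [Function.comp, intervalIntegral.integral_of_le hR, ← integral_conj]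
  refine integral_congr_ae (Eventually.of_forall fun x => ?_)
  simp only [map_mul, Complex.conj_conj]
  ring

theorem green_re_none {f w : Lp ℂ 2 (volume.restrict (Ici (0 : ℝ)))}
    {u u' u'' : ℝ → ℂ} (h : IsH2Rep (Ici 0) f u u' u'')
    (hw : w =ᵐ[volume.restrict (Ici 0)] fun x => -u'' x) :
    0 ≤ (⟪w, f⟫_ℂ - conj (u' 0) * u 0).re := by
  -- Using `|R|` makes the truncated energy nonnegative for every real `R`, not just eventually.
  refine ge_of_tendsto' (α := ℝ) (f := (fun R : ℝ => (∫ x in 0..|R|, conj (u' x) * u' x).re))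
    (x := atTop)
    ((Complex.continuous_re.tendsto _).comp ((tendsto_integral_lead h h hw).comp
      tendsto_abs_atTop_atTop)) fun R => ?_
  have e : ∀ x, conj (u' x) * u' x = ((‖u' x‖ ^ 2 : ℝ) : ℂ) := fun x => by
    rw [Complex.conj_mul']
    push_cast
    rfl
  simp_rw [e]
  rw [intervalIntegral.integral_ofReal, Complex.ofReal_re]
  exact intervalIntegral.integral_nonneg (abs_nonneg R) fun _ _ => sq_nonneg _

/-- The integrals of `u` over the pieces of the edge are inner products with indicator functions, so
the bound involves only bounded functionals on `L²`, not point values. The constant is absorbed into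
the vectors `b i`. -/
theorem green_re_some {ℓ : ℝ} (hℓ : 0 < ℓ) {q : ℝ → ℝ}
    (hq : MemLp q 2 (volume.restrict (Icc 0 ℓ))) :
    ∃ (n : ℕ) (b : Fin n → Lp ℂ 2 (volume.restrict (Icc 0 ℓ))),
      ∀ (f w : Lp ℂ 2 (volume.restrict (Icc 0 ℓ))) (u u' u'' : ℝ → ℂ),
      IsH2Rep (Icc 0 ℓ) f u u' u'' →
      w =ᵐ[volume.restrict (Icc 0 ℓ)] (fun x => -u'' x + (q x : ℂ) * u x) →
      -(∑ i, ‖⟪b i, f⟫_ℂ‖ ^ 2) ≤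
        (⟪w, f⟫_ℂ - (conj (u' 0) * u 0 - conj (u' ℓ) * u ℓ)).re := by
  obtain ⟨n, c, a, ha, hform⟩ := exists_neg_sum_le_form hℓ hq
  have hfin : ∀ i, (volume.restrict (Icc 0 ℓ)) (Ioc (a i) (a (i + 1))) ≠ ⊤ :=
    fun i => measure_ne_top _ _
  refine ⟨n, fun i => (c : ℂ) • indicatorConstLp 2 measurableSet_Ioc (hfin i) 1,
    fun f w u u' u'' h hw => ?_⟩
  rw [inner_sub_boundary hℓ hq h h hw]
  have e : ∀ x, conj (u' x) * u' x + (q x : ℂ) * (conj (u x) * u x) =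
      ((‖u' x‖ ^ 2 + q x * ‖u x‖ ^ 2 : ℝ) : ℂ) := fun x => by
    rw [Complex.conj_mul', Complex.conj_mul']
    push_cast
    rfl
  simp_rw [e]
  rw [intervalIntegral.integral_ofReal, Complex.ofReal_re]
  refine le_trans (le_of_eq ?_)
    (hform u u' h.deriv_one (h.continuousOn_deriv le_rfl hℓ.le subset_rfl))
  rw [Finset.sum_range]
  congr 1
  refine Finset.sum_congr rfl fun i _ => ?_
  obtain ⟨h0, h1, h2⟩ := ha i i.2
  have hsub : Ioc (a i) (a (i + 1)) ⊆ Icc 0 ℓ := fun t ht => ⟨h0.trans ht.1.le, ht.2.trans h2⟩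
  rw [inner_smul_left, L2.inner_indicatorConstLp_one, Complex.conj_ofReal, norm_mul, mul_pow,
    Complex.norm_real, Real.norm_eq_abs, sq_abs, Measure.restrict_restrict measurableSet_Ioc,
    inter_eq_left.2 hsub, intervalIntegral.integral_of_le h1]
  congr 3
  refine integral_congr_ae ?_
  exact ae_mono (Measure.restrict_mono hsub le_rfl) h.ae_eq

end Form

/-- Collects the functionals of all finite edges into one operator of finite rank; the lead needs
none. -/
theorem exists_clm_norm_sq_eq {E : Type*} [Fintype E] {β : Option E → Type*}
    [∀ e, NormedAddCommGroup (β e)] [∀ e, InnerProductSpace ℂ (β e)] {n : E → ℕ}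
    (b : ∀ e, Fin (n e) → β (some e)) :
    ∃ T : PiLp 2 β →L[ℂ] EuclideanSpace ℂ (Σ e, Fin (n e)),
      ∀ y, ‖T y‖ ^ 2 = ∑ e, ∑ i, ‖⟪b e i, y (some e)⟫_ℂ‖ ^ 2 := by
  refine ⟨(PiLp.continuousLinearEquiv 2 ℂ
    (fun _ : Σ e, Fin (n e) => ℂ)).symm.toContinuousLinearMap.comp
    (ContinuousLinearMap.pi fun i => (innerSL ℂ (b i.1 i.2)).comp (PiLp.proj 2 β (some i.1))),
    fun y => ?_⟩
  rw [PiLp.norm_sq_eq_of_L2, Fintype.sum_sigma]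
  rfl

section Graph

variable {V : Type*} [DecidableEq V] {G : SimpleGraph V} [Fintype G.edgeSet]
  {o : EdgeOrientation G} {root : V} {ℓ : ℝ} {q : G.edgeSet → ℝ → ℝ}

/-- Group the edge ends by vertex. All ends at `x` carry the same value `c x`, whose coefficient is
the conjugate of the Kirchhoff defect of `u'` at `x`. -/
theorem sum_boundaryTerm_eq_zero [Fintype V] {u' v : Option G.edgeSet → ℝ → ℂ}
    (hu : Kirchhoff o root ℓ u') (hv : ContinuousAtVertices o root ℓ v) :
    ∑ e, boundaryTerm ℓ (u' e) (v e) e = 0 := by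
  obtain ⟨c, h0, h1⟩ := hv
  have h2 : ∑ e, boundaryTerm ℓ (u' e) (v e) e =
      ∑ e, conj (u' e 0) * v e 0 - ∑ e, conj (u' (some e) ℓ) * v (some e) ℓ := by
    rw [Fintype.sum_option, Fintype.sum_option]
    simp only [boundaryTerm, Finset.sum_sub_distrib]
    ring
  rw [h2, sub_eq_zero]
  simp only [h0, h1]
  rw [← Finset.sum_fiberwise Finset.univ (initialVertex o root),
    ← Finset.sum_fiberwise Finset.univ o.tgt]
  refine Finset.sum_congr rfl fun x _ => ?_
  have hx := congrArg (fun z => conj z * c x) (hu x)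
  simp only [map_sum, Finset.sum_mul] at hx
  rw [Finset.sum_congr rfl fun e he => by rw [(Finset.mem_filter.1 he).2],
    ← hx]
  refine Finset.sum_congr rfl fun e he => by rw [(Finset.mem_filter.1 he).2]

theorem isGraphPair_apply (hℓ : 0 < ℓ) (y : (schrodingerOperator o root ℓ q).domain) :
    IsGraphPair o root ℓ q y (schrodingerOperator o root ℓ q y) :=
  (mem_graph_schrodingerOperator o root hℓ q _ _).1 (LinearPMap.mem_graph _ y)

theorem exists_domain_of_isGraphPair (hℓ : 0 < ℓ) {y w : L2Space G.edgeSet ℓ}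
    (h : IsGraphPair o root ℓ q y w) :
    ∃ z : (schrodingerOperator o root ℓ q).domain, (z : L2Space G.edgeSet ℓ) = y ∧
      schrodingerOperator o root ℓ q z = w :=
  (LinearPMap.mem_graph_iff _).1 ((mem_graph_schrodingerOperator o root hℓ q y w).2 h)

theorem schrodingerOperator_isFormalAdjoint [Fintype V] (hℓ : 0 < ℓ)
    (hq : ∀ e, MemLp (q e) 2 (volume.restrict (Icc 0 ℓ))) :
    (schrodingerOperator o root ℓ q).IsFormalAdjoint (schrodingerOperator o root ℓ q) := by
  intro y z
  obtain ⟨u, u', u'', hu, huc, huk, hw⟩ := isGraphPair_apply hℓ y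
  obtain ⟨v, v', v'', hv, hvc, hvk, ht⟩ := isGraphPair_apply hℓ z
  set w := schrodingerOperator o root ℓ q y
  set t := schrodingerOperator o root ℓ q z
  have key : ∀ e, ⟪w e, (z : L2Space G.edgeSet ℓ) e⟫_ℂ - boundaryTerm ℓ (u' e) (v e) e =
      conj (⟪t e, (y : L2Space G.edgeSet ℓ) e⟫_ℂ - boundaryTerm ℓ (v' e) (u e) e) := by
    rintro (_ | e)
    · exact green_symm_none (hu none) (hv none)
        ((hw none).trans (Eventually.of_forall fun x => by simp [extendByZero]))
        ((ht none).trans (Eventually.of_forall fun x => by simp [extendByZero]))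
    · exact green_symm_some hℓ (hq e) (hu (some e)) (hv (some e)) (hw (some e)) (ht (some e))
  have hsum := Finset.sum_congr (rfl : Finset.univ = Finset.univ) fun e _ => key e
  rw [← map_sum, Finset.sum_sub_distrib, Finset.sum_sub_distrib, sum_boundaryTerm_eq_zero huk hvc,
    sum_boundaryTerm_eq_zero hvk huc, sub_zero, sub_zero, ← PiLp.inner_apply, ← PiLp.inner_apply,
    inner_conj_symm] at hsum
  exact hsum

/-- The vertex terms cancel, the lead contributes a nonnegative amount, and each finite edge is
bounded below by its own finite-rank term. -/
theorem exists_finite_rank_bound [Fintype V] (hℓ : 0 < ℓ)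
    (hq : ∀ e, MemLp (q e) 2 (volume.restrict (Icc 0 ℓ))) :
    ∃ (n : G.edgeSet → ℕ) (T : L2Space G.edgeSet ℓ →L[ℂ]
      EuclideanSpace ℂ (Σ e : G.edgeSet, Fin (n e))),
      ∀ y : (schrodingerOperator o root ℓ q).domain,
        -‖T y‖ ^ 2 ≤ (⟪schrodingerOperator o root ℓ q y, (y : L2Space G.edgeSet ℓ)⟫_ℂ).re := by
  choose n b hb using fun e => green_re_some hℓ (hq e)
  obtain ⟨T, hT⟩ := exists_clm_norm_sq_eq (β := fun e : Option G.edgeSet =>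
    Lp ℂ 2 (volume.restrict (edgeInterval ℓ e))) b
  refine ⟨n, T, fun y => ?_⟩
  obtain ⟨u, u', u'', hu, huc, huk, hw⟩ := isGraphPair_apply hℓ y
  set w := schrodingerOperator o root ℓ q y
  have hsum : (⟪w, (y : L2Space G.edgeSet ℓ)⟫_ℂ).re =
      ∑ e, (⟪w e, (y : L2Space G.edgeSet ℓ) e⟫_ℂ - boundaryTerm ℓ (u' e) (u e) e).re := by
    rw [← Complex.re_sum, Finset.sum_sub_distrib, sum_boundaryTerm_eq_zero huk huc, sub_zero,
      ← PiLp.inner_apply]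
  rw [hsum, hT, Fintype.sum_option, ← Finset.sum_neg_distrib]
  refine le_add_of_nonneg_of_le ?_ (Finset.sum_le_sum fun e _ => ?_)
  · exact green_re_none (hu none)
      ((hw none).trans (Eventually.of_forall fun x => by simp [extendByZero]))
  · exact hb e _ _ _ _ _ (hu (some e)) (hw (some e))

end Graph

end LeadGraph

/-! ### Initial value problems on a finite edge -/

namespace LeadGraph

theorem measurableSet_edgeInterval {E : Type*} (ℓ : ℝ) (e : Option E) :
    MeasurableSet (edgeInterval ℓ e) := by
  cases e
  · exact measurableSet_Ici
  · exact measurableSet_Icc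

theorem Icc_subset_edgeInterval {E : Type*} {ℓ : ℝ} {e : Option E} {b : ℝ}
    (hb : b ∈ edgeInterval ℓ e) : 0 ≤ b ∧ Icc 0 b ⊆ edgeInterval ℓ e := by
  cases e
  · exact ⟨hb, fun t ht => ht.1⟩
  · exact ⟨hb.1, Icc_subset_Icc_right hb.2⟩

/-- Solutions are constructed from integral equations; a primitive of a square integrable function
is absolutely continuous, and Lebesgue differentiation supplies its derivative almost everywhere. -/
theorem isH2Rep_of_integral {E : Type*} {ℓ : ℝ} {e : Option E} {u u' g : ℝ → ℂ} {c : ℂ}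
    (hg : MemLp g 2 (volume.restrict (edgeInterval ℓ e)))
    (hu : ∀ x ∈ edgeInterval ℓ e, HasDerivWithinAt u (u' x) (edgeInterval ℓ e) x)
    (hu' : ∀ x ∈ edgeInterval ℓ e, u' x = c + ∫ t in 0..x, g t) :
    IsH2Rep (edgeInterval ℓ e) u u u' g where
  ae_eq := ae_eq_refl u
  deriv_one := hu
  abs_cont b hb := by
    obtain ⟨hb0, hbJ⟩ := Icc_subset_edgeInterval hb
    refine ((MemLp.intervalIntegrable_of_subset hg hb0
      hbJ).absolutelyContinuousOnInterval_integral (c := 0) left_mem_uIcc).of_dist_le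
      fun x hx y hy => ?_
    rw [uIcc_of_le hb0] at hx hy
    rw [hu' x (hbJ hx), hu' y (hbJ hy), dist_add_left]
  deriv_two := by
    have hm := measurableSet_edgeInterval ℓ e
    -- Extension by zero gives a locally integrable function on the whole line, to which the
    -- two-sided differentiation theorem applies.
    have hloc : LocallyIntegrable ((edgeInterval ℓ e).indicator g) volume :=
      ((memLp_indicator_iff_restrict hm).2 hg).locallyIntegrable one_le_two
    rw [ae_restrict_iff' hm]
    filter_upwards [_root_.LocallyIntegrable.ae_hasDerivAt_integral hloc] with x hx hxJ
    have h1 := ((hx 0).const_add c).hasDerivWithinAt (s := edgeInterval ℓ e)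
    rw [indicator_of_mem hxJ] at h1
    have heq : ∀ y ∈ edgeInterval ℓ e,
        u' y = c + ∫ t in 0..y, (edgeInterval ℓ e).indicator g t := by
      intro y hy
      obtain ⟨hy0, hyJ⟩ := Icc_subset_edgeInterval hy
      rw [hu' y hy]
      congr 1
      refine intervalIntegral.integral_congr fun t ht => ?_
      rw [uIcc_of_le hy0] at ht
      exact (indicator_of_mem (hyJ ht) g).symm
    exact h1.congr heq (heq x hxJ)
  memLp_two := hg

/-- Existence for the Volterra integral equation `u'' = p u - f`, `u 0 = a`, `u' 0 = b`. -/
theorem exists_volterra {ℓ : ℝ} (hℓ : 0 < ℓ) {p f : ℝ → ℂ} (hp : Integrable p) (hf : Integrable f)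
    (a b : ℂ) : ∃ u : ℝ → ℂ, Continuous u ∧
      ∀ x ∈ Icc 0 ℓ, u x = a + ∫ s in 0..x, (b + ∫ t in 0..s, (p t * u t - f t)) := by
  set N := ∫ t, ‖p t‖
  have hN : 0 ≤ N := integral_nonneg fun _ => norm_nonneg _
  -- The unknown is the weighted function `v t = exp (-M t) u t`; in the weighted norm the integral
  -- operator has Lipschitz constant at most `N / M ≤ 1 / 2`, so a single contraction covers the
  -- whole edge. The summand `1` keeps `M` positive when `p` vanishes.
  set M := 2 * N + 1
  have hM : 0 < M := by positivity
  let U : C(Icc (0 : ℝ) ℓ, ℂ) → ℝ → ℂ := fun v t =>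
    (Real.exp (M * (projIcc 0 ℓ hℓ.le t : ℝ)) : ℂ) * v (projIcc 0 ℓ hℓ.le t)
  have hUc : ∀ v, Continuous (U v) := fun v => by
    have : Continuous (projIcc (0 : ℝ) ℓ hℓ.le) := continuous_projIcc
    fun_prop
  have hUb : ∀ v, ∃ C, ∀ t, ‖U v t‖ ≤ C := fun v => by
    refine ⟨Real.exp (M * ℓ) * ‖v‖, fun t => ?_⟩
    rw [norm_mul, Complex.norm_real, Real.norm_eq_abs, abs_of_pos (Real.exp_pos _)]
    have := (projIcc 0 ℓ hℓ.le t).2.2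
    gcongr
    exact v.norm_coe_le_norm _
  have hpU : ∀ v, Integrable (fun t => p t * U v t) := fun v => by
    obtain ⟨C, hC⟩ := hUb v
    exact hp.mul_bdd (hUc v).aestronglyMeasurable (Eventually.of_forall hC)
  have hpUf : ∀ v, Integrable (fun t => p t * U v t - f t) := fun v => (hpU v).sub hf
  have hin : ∀ v, Continuous fun s : ℝ => b + ∫ t in 0..s, (p t * U v t - f t) := fun v =>
    continuous_const.add (intervalIntegral.continuous_primitive
      (fun _ _ => (hpUf v).intervalIntegrable) 0)
  let W : C(Icc (0 : ℝ) ℓ, ℂ) → ℝ → ℂ := fun v x =>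
    a + ∫ s in 0..x, (b + ∫ t in 0..s, (p t * U v t - f t))
  have hW : ∀ v, Continuous (W v) := fun v =>
    continuous_const.add (intervalIntegral.continuous_primitive
      (fun _ _ => (hin v).intervalIntegrable _ _) 0)
  let T : C(Icc (0 : ℝ) ℓ, ℂ) → C(Icc (0 : ℝ) ℓ, ℂ) := fun v =>
    ⟨fun x => (Real.exp (-(M * x)) : ℂ) * W v x, by
      have := hW v
      fun_prop⟩
  have hT : ∀ v w, dist (T v) (T w) ≤ 1 / 2 * dist v w := by
    intro v w
    rw [ContinuousMap.dist_le (by positivity)]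
    rintro ⟨x, hx⟩
    have hdiff : W v x - W w x = ∫ s in 0..x, ∫ t in 0..s, p t * (U v t - U w t) := by
      simp only [W]
      rw [add_sub_add_left_eq_sub, ← intervalIntegral.integral_sub
        ((hin v).intervalIntegrable _ _) ((hin w).intervalIntegrable _ _)]
      refine intervalIntegral.integral_congr fun s _ => ?_
      change b + _ - (b + _) = _
      rw [add_sub_add_left_eq_sub, ← intervalIntegral.integral_sub
        (hpUf v).intervalIntegrable (hpUf w).intervalIntegrable]
      refine intervalIntegral.integral_congr fun t _ => ?_
      ring
    -- The inner integral uses only the `L¹` norm of `p` and keeps the factor `exp (M s)`; the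
    -- factor `1 / M` is gained when the outer integral integrates this exponential.
    have hinner : ∀ s ∈ Icc 0 x, ‖∫ t in 0..s, p t * (U v t - U w t)‖ ≤
        N * dist v w * Real.exp (M * s) := by
      intro s hs
      have hb : ∀ t ∈ Ioc 0 s, ‖p t * (U v t - U w t)‖ ≤
          ‖p t‖ * (Real.exp (M * s) * dist v w) := by
        intro t ht
        have ht' : t ∈ Icc 0 ℓ := ⟨ht.1.le, ht.2.trans (hs.2.trans hx.2)⟩
        simp only [U]
        rw [projIcc_of_mem hℓ.le ht', ← mul_sub, norm_mul, norm_mul, Complex.norm_real,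
          Real.norm_eq_abs, abs_of_pos (Real.exp_pos _), ← dist_eq_norm]
        have h1 := ContinuousMap.dist_apply_le_dist (f := v) (g := w) ⟨t, ht'⟩
        have h2 := ht.2
        gcongr
      refine (intervalIntegral.norm_integral_le_of_norm_le hs.1 (ae_of_all _ hb)
        (hp.norm.mul_const _).intervalIntegrable).trans ?_
      rw [intervalIntegral.integral_mul_const, intervalIntegral.integral_of_le hs.1]
      have h1 : ∫ t in Ioc 0 s, ‖p t‖ ≤ N :=
        setIntegral_le_integral hp.norm (Eventually.of_forall fun _ => norm_nonneg _)
      have h2 : 0 ≤ Real.exp (M * s) * dist v w := by positivity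
      calc _ ≤ N * (Real.exp (M * s) * dist v w) := mul_le_mul_of_nonneg_right h1 h2
        _ = _ := by ring
    have hexp : ∫ s in 0..x, Real.exp (M * s) = (Real.exp (M * x) - 1) / M := by
      rw [intervalIntegral.integral_comp_mul_left (fun s => Real.exp s) hM.ne', integral_exp]
      simp [div_eq_inv_mul]
    have houter : ‖W v x - W w x‖ ≤ N * dist v w * (Real.exp (M * x) / M) := by
      rw [hdiff]
      refine (intervalIntegral.norm_integral_le_of_norm_le hx.1
        (ae_of_all _ fun s hs => hinner s (Ioc_subset_Icc_self hs))
        (Continuous.intervalIntegrable (by fun_prop) _ _)).trans ?_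
      rw [intervalIntegral.integral_const_mul, hexp]
      gcongr
      linarith
    change dist ((Real.exp (-(M * x)) : ℂ) * W v x) ((Real.exp (-(M * x)) : ℂ) * W w x) ≤ _
    rw [dist_eq_norm, ← mul_sub, norm_mul, Complex.norm_real, Real.norm_eq_abs,
      abs_of_pos (Real.exp_pos _)]
    calc _ ≤ Real.exp (-(M * x)) * (N * dist v w * (Real.exp (M * x) / M)) := by gcongr
      _ = N / M * dist v w * (Real.exp (-(M * x)) * Real.exp (M * x)) := by ring
      _ = N / M * dist v w := by rw [← Real.exp_add]; simp
      _ ≤ 1 / 2 * dist v w := by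
        refine mul_le_mul_of_nonneg_right ?_ dist_nonneg
        rw [div_le_div_iff₀ hM two_pos]
        simp only [M]
        linarith
  have hcontr : ContractingWith (1 / 2) T :=
    ⟨by rw [← NNReal.coe_lt_coe]; norm_num, LipschitzWith.of_dist_le_mul (by simpa using hT)⟩
  set v := hcontr.fixedPoint T
  have hv : T v = v := hcontr.fixedPoint_isFixedPt
  refine ⟨U v, hUc v, fun x hx => ?_⟩
  have h1 : (Real.exp (-(M * x)) : ℂ) * W v x = v ⟨x, hx⟩ := DFunLike.congr_fun hv ⟨x, hx⟩
  change U v x = W v x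
  simp only [U]
  rw [projIcc_of_mem hℓ.le hx, ← h1, ← mul_assoc, ← Complex.ofReal_mul, ← Real.exp_add]
  simp

/-- The initial value problem `-u'' + p u = f`, `u 0 = a`, `u' 0 = b` on an edge. -/
theorem exists_edge_solution {E : Type*} (e : E) {ℓ : ℝ} (hℓ : 0 < ℓ) {p f : ℝ → ℂ}
    (hp : MemLp p 2 (volume.restrict (Icc 0 ℓ))) (hf : MemLp f 2 (volume.restrict (Icc 0 ℓ)))
    (a b : ℂ) : ∃ u u' u'' : ℝ → ℂ, IsH2Rep (edgeInterval ℓ (some e)) u u u' u'' ∧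
      u 0 = a ∧ u' 0 = b ∧ ∀ x ∈ Icc 0 ℓ, -u'' x + p x * u x = f x := by
  have hpi : Integrable ((Icc 0 ℓ).indicator p) :=
    (integrable_indicator_iff measurableSet_Icc).2 (hp.integrable one_le_two)
  have hfi : Integrable ((Icc 0 ℓ).indicator f) :=
    (integrable_indicator_iff measurableSet_Icc).2 (hf.integrable one_le_two)
  obtain ⟨u, huc, hu⟩ := exists_volterra hℓ hpi hfi a b
  obtain ⟨C, hC⟩ := isCompact_Icc.exists_bound_of_continuousOn (huc.continuousOn (s := Icc 0 ℓ))
  set u'' : ℝ → ℂ := fun t => (Icc 0 ℓ).indicator p t * u t - (Icc 0 ℓ).indicator f t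
  set u' : ℝ → ℂ := fun s => b + ∫ t in 0..s, u'' t
  have hmem : MemLp u'' 2 (volume.restrict (Icc 0 ℓ)) := by
    have h1 : MemLp (fun t => p t * u t - f t) 2 (volume.restrict (Icc 0 ℓ)) := by
      refine MemLp.sub ?_ hf
      refine (hp.norm.mul_const C).mono (hp.aestronglyMeasurable.mul huc.aestronglyMeasurable) ?_
      filter_upwards [ae_restrict_mem measurableSet_Icc] with t ht
      rw [norm_mul, norm_mul, norm_norm, Real.norm_eq_abs]
      gcongr
      exact (hC t ht).trans (le_abs_self C)
    refine (memLp_congr_ae ?_).1 h1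
    filter_upwards [ae_restrict_mem measurableSet_Icc] with t ht
    simp only [u'', indicator_of_mem ht]
  have hi : ∀ x y, IntervalIntegrable u'' volume x y := fun x y =>
    ((hpi.intervalIntegrable).mul_continuousOn huc.continuousOn).sub hfi.intervalIntegrable
  have huc' : Continuous u' :=
    continuous_const.add (intervalIntegral.continuous_primitive hi 0)
  refine ⟨u, u', u'', isH2Rep_of_integral (c := b) hmem ?_ fun x _ => rfl, ?_, ?_, fun x hx => ?_⟩
  · intro x hx
    exact ((huc'.integral_hasStrictDerivAt 0 x).hasDerivAt.const_add a).hasDerivWithinAt.congr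
      (fun y hy => hu y hy) (hu x hx)
  · rw [hu 0 (left_mem_Icc.2 hℓ.le)]
    simp
  · simp [u']
  · simp only [u'', indicator_of_mem hx]
    ring

end LeadGraph

/-! ### Square integrable solutions on the lead -/

namespace LeadGraph

open scoped ENNReal in
/-- Young's inequality for an integrable kernel and a square integrable function. -/
theorem memLp_two_of_enorm_le_lintegral {k : ℝ → ℝ≥0∞} (hk : Measurable k) (hk1 : ∫⁻ x, k x ≠ ∞)
    {g h : ℝ → ℂ} (hg : MemLp g 2) {S : Set ℝ} (hS : MeasurableSet S)
    (hh : AEStronglyMeasurable h (volume.restrict S))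
    (hb : ∀ x ∈ S, ‖h x‖ₑ ≤ ∫⁻ t, k (x - t) * ‖g t‖ₑ) : MemLp h 2 (volume.restrict S) := by
  refine ⟨hh, (eLpNorm_lt_top_iff_lintegral_rpow_enorm_lt_top two_ne_zero ENNReal.ofNat_ne_top).2 ?_⟩
  have hg2 : ∫⁻ t, ‖g t‖ₑ ^ (2 : ℝ) < ∞ := by
    have := (eLpNorm_lt_top_iff_lintegral_rpow_enorm_lt_top two_ne_zero
      ENNReal.ofNat_ne_top).1 hg.2
    simpa using this
  have hG : AEMeasurable (fun t => ‖g t‖ₑ) := hg.1.enorm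
  set K := ∫⁻ x, k x
  -- Cauchy-Schwarz after splitting the kernel as `k = k^(1/2) * k^(1/2)`; one half produces the
  -- factor `K`.
  have hcs : ∀ x, (∫⁻ t, k (x - t) * ‖g t‖ₑ) ^ (2 : ℝ) ≤
      K * ∫⁻ t, k (x - t) * ‖g t‖ₑ ^ (2 : ℝ) := by
    intro x
    have hkx : Measurable fun t => k (x - t) := hk.comp (measurable_const.sub measurable_id)
    have h1 := ENNReal.lintegral_mul_le_Lp_mul_Lq volume Real.HolderConjugate.two_two
      (f := fun t => k (x - t) ^ (1 / 2 : ℝ)) (g := fun t => k (x - t) ^ (1 / 2 : ℝ) * ‖g t‖ₑ)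
      (hkx.pow_const _).aemeasurable ((hkx.pow_const _).aemeasurable.mul hG)
    have e1 : ∀ t, ((fun t => k (x - t) ^ (1 / 2 : ℝ)) *
        fun t => k (x - t) ^ (1 / 2 : ℝ) * ‖g t‖ₑ) t = k (x - t) * ‖g t‖ₑ := fun t => by
      rw [Pi.mul_apply, ← mul_assoc, ← ENNReal.rpow_add_of_nonneg _ _ (by norm_num) (by norm_num)]
      norm_num
    have e2 : ∀ a : ℝ≥0∞, (a ^ (1 / 2 : ℝ)) ^ (2 : ℝ) = a := fun a => by
      rw [← ENNReal.rpow_mul]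
      norm_num
    simp_rw [e1, ENNReal.mul_rpow_of_nonneg _ _ (zero_le_two : (0 : ℝ) ≤ 2), e2] at h1
    rw [lintegral_sub_left_eq_self] at h1
    have h2 := ENNReal.rpow_le_rpow h1 (zero_le_two : (0 : ℝ) ≤ 2)
    rwa [ENNReal.mul_rpow_of_nonneg _ _ (zero_le_two : (0 : ℝ) ≤ 2), e2, e2] at h2
  have hmeas : AEMeasurable (Function.uncurry fun x t : ℝ => k (x - t) * ‖g t‖ₑ ^ (2 : ℝ))
      ((volume : Measure ℝ).prod volume) :=
    (hk.comp measurable_sub).aemeasurable.mul ((hG.pow_const _).comp_snd)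
  calc ∫⁻ x in S, ‖h x‖ₑ ^ (2 : ℝ)
      ≤ ∫⁻ x in S, K * ∫⁻ t, k (x - t) * ‖g t‖ₑ ^ (2 : ℝ) :=
        setLIntegral_mono' hS fun x hx =>
          (ENNReal.rpow_le_rpow (hb x hx) zero_le_two).trans (hcs x)
    _ ≤ ∫⁻ x, K * ∫⁻ t, k (x - t) * ‖g t‖ₑ ^ (2 : ℝ) := setLIntegral_le_lintegral _ _
    _ = K * ∫⁻ x, ∫⁻ t, k (x - t) * ‖g t‖ₑ ^ (2 : ℝ) := lintegral_const_mul' _ _ hk1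
    _ = K * ∫⁻ t, ∫⁻ x, k (x - t) * ‖g t‖ₑ ^ (2 : ℝ) := by rw [lintegral_lintegral_swap hmeas]
    _ = K * ∫⁻ t, K * ‖g t‖ₑ ^ (2 : ℝ) := by
        congr 1
        refine lintegral_congr fun t => ?_
        have hkt : Measurable fun x => k (x - t) := hk.comp (measurable_id.sub_const t)
        rw [lintegral_mul_const _ hkt, lintegral_sub_right_eq_self]
    _ = K * (K * ∫⁻ t, ‖g t‖ₑ ^ (2 : ℝ)) := by rw [lintegral_const_mul' _ _ hk1]
    _ < ∞ := ENNReal.mul_lt_top hk1.lt_top (ENNReal.mul_lt_top hk1.lt_top hg2)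

theorem integrable_exp_neg_mul_abs {r : ℝ} (hr : 0 < r) :
    Integrable fun x : ℝ => Real.exp (-(r * |x|)) := by
  rw [← integrableOn_univ, ← Iic_union_Ioi (a := (0 : ℝ)), integrableOn_union]
  constructor
  · refine (integrableOn_exp_mul_Iic hr 0).congr_fun (fun x hx => ?_) measurableSet_Iic
    simp [abs_of_nonpos (show x ≤ 0 from hx)]
  · refine (integrableOn_exp_mul_Ioi (neg_lt_zero.2 hr) 0).congr_fun (fun x hx => ?_)
      measurableSet_Ioi
    simp [abs_of_pos (show 0 < x from hx)]

theorem norm_exp_mul_ofReal (κ : ℂ) (x : ℝ) : ‖Complex.exp (κ * x)‖ = Real.exp (κ.re * x) := by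
  rw [Complex.norm_exp]
  simp

theorem hasDerivAt_exp_mul_ofReal (κ : ℂ) (x : ℝ) :
    HasDerivAt (fun x : ℝ => Complex.exp (κ * x)) (κ * Complex.exp (κ * x)) x := by
  have h : HasDerivAt (fun x : ℝ => κ * (x : ℂ)) κ x := by
    simpa using (Complex.ofRealCLM.hasDerivAt (x := x)).const_mul κ
  exact h.cexp.congr_deriv (mul_comm _ _)

theorem memLp_exp {κ : ℂ} (hκ : κ.re < 0) :
    MemLp (fun x : ℝ => Complex.exp (κ * x)) 2 (volume.restrict (Ici 0)) := by
  rw [memLp_two_iff_integrable_sq_norm (Continuous.aestronglyMeasurable (by fun_prop))]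
  have h : κ.re + κ.re < 0 := by linarith
  have := (integrableOn_Ici_iff_integrableOn_Ioi).2 (integrableOn_exp_mul_Ioi h 0)
  refine this.congr (Eventually.of_forall fun x => ?_)
  simp only [norm_exp_mul_ofReal]
  rw [sq, ← Real.exp_add, add_mul]

/-- If a continuous function on `[0, ∞)` is an integral of a square integrable function against
`exp (± κ (x - t))`, on the side where this decays, then it is square integrable. -/
theorem memLp_of_exp_kernel {r : ℝ} (hr : 0 < r) {g h : ℝ → ℂ} (hg : MemLp g 2)
    (hh : Continuous h) {s : ℝ → Set ℝ} {a : ℝ → ℝ → ℂ} (hs : ∀ x, MeasurableSet (s x))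
    (ha : ∀ x, ∀ t ∈ s x, ‖a x t‖ ≤ Real.exp (-(r * |x - t|)))
    (hb : ∀ x, 0 ≤ x → h x = ∫ t in s x, a x t * g t) :
    MemLp h 2 (volume.restrict (Ici 0)) := by
  refine memLp_two_of_enorm_le_lintegral (k := fun s => ENNReal.ofReal (Real.exp (-(r * |s|))))
    (ENNReal.measurable_ofReal.comp (Continuous.measurable (by fun_prop))) ?_ hg measurableSet_Ici hh.aestronglyMeasurable
    fun x hx => ?_
  · rw [← ofReal_integral_eq_lintegral_ofReal (integrable_exp_neg_mul_abs hr)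
      (Eventually.of_forall fun _ => (Real.exp_pos _).le)]
    exact ENNReal.ofReal_ne_top
  · rw [hb x hx]
    refine (enorm_integral_le_lintegral_enorm _).trans ?_
    refine le_trans (setLIntegral_mono' (hs x) fun t ht => ?_) (setLIntegral_le_lintegral (s x) _)
    rw [enorm_mul]
    gcongr
    rw [← ofReal_norm]
    exact ENNReal.ofReal_le_ofReal (ha x t ht)

/-- Existence of a square integrable solution of `-u'' + κ² u = f` on the lead. -/
theorem exists_lead_solution (E : Type*) (ℓ : ℝ) {κ : ℂ} (hκ : 0 < κ.re) {f : ℝ → ℂ}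
    (hf : MemLp f 2 (volume.restrict (Ici 0))) :
    ∃ u u' u'' : ℝ → ℂ, IsH2Rep (edgeInterval ℓ (none : Option E)) u u u' u'' ∧
      MemLp u 2 (volume.restrict (Ici 0)) ∧ ∀ x ∈ Ici 0, -u'' x + κ ^ 2 * u x = f x := by
  set F : ℝ → ℂ := (Ici 0).indicator f
  have hF : MemLp F 2 := (memLp_indicator_iff_restrict measurableSet_Ici).2 hf
  have hFii : ∀ a b : ℝ, IntervalIntegrable F volume a b := fun a b =>
    ((hF.locallyIntegrable one_le_two).integrableOn_isCompact isCompact_uIcc).intervalIntegrable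
  have hκ' : (-κ).re < 0 := by simpa using hκ
  have hP : Integrable fun t : ℝ => Complex.exp (-κ * t) * F t := by
    have h1 := (memLp_exp hκ').integrable_mul hf
    replace h1 := (integrable_indicator_iff measurableSet_Ici).2 h1
    refine h1.congr (Eventually.of_forall fun t => ?_)
    by_cases ht : t ∈ Ici (0 : ℝ)
    · simp [F, ht, indicator_of_mem]
    · simp [F, ht, indicator_of_notMem]
  -- The operator factors: with `w = u' + κ u`, the equation `-u'' + κ² u = F` becomes `w' = κ w -
  -- F`. Its decaying solution is `w x = ∫ exp (κ (x - t)) F t` over `t > x`, so the integration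
  -- must start from infinity; `C` is the total integral that arranges this.
  set C := ∫ t in Ioi 0, Complex.exp (-κ * (t : ℝ)) * F t
  let I : ℝ → ℂ := fun x => C - ∫ t in 0..x, Complex.exp (-κ * (t : ℝ)) * F t
  have hIc : Continuous I := continuous_const.sub
    (intervalIntegral.continuous_primitive (fun _ _ => hP.intervalIntegrable) 0)
  have hI : ∀ x, 0 ≤ x → I x = ∫ t in Ioi x, Complex.exp (-κ * (t : ℝ)) * F t := fun x hx => by
    have := intervalIntegral.integral_interval_add_Ioi (hP.integrableOn (s := Ioi 0))
      (hP.integrableOn (s := Ioi x))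
    simp only [I, C]
    rw [← this]
    ring
  let w : ℝ → ℂ := fun x => Complex.exp (κ * x) * I x
  have hwc : Continuous w := by fun_prop
  have hwint : ∀ x, 0 ≤ x → w x = w 0 + ∫ t in 0..x, (κ * w t - F t) := by
    intro x hx
    have hac : AbsolutelyContinuousOnInterval
        (fun x => Complex.exp (κ * (x : ℝ)) • I x) 0 x := by
      refine (absolutelyContinuousOnInterval_of_hasDerivWithinAt
        (fun t _ => (hasDerivAt_exp_mul_ofReal κ t).hasDerivWithinAt)
        (Continuous.continuousOn (by fun_prop))).fun_smul ?_
      refine (hP.intervalIntegrable.absolutelyContinuousOnInterval_integral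
        (c := 0) left_mem_uIcc).of_dist_le fun s _ t _ => ?_
      rw [dist_sub_left]
    have hwi : IntervalIntegrable (fun t => κ * w t) volume 0 x :=
      (continuous_const.mul hwc).intervalIntegrable _ _
    have := hac.integral_eq_sub (f' := fun t => κ * w t - F t) hx (by
      filter_upwards [_root_.LocallyIntegrable.ae_hasDerivAt_integral hP.locallyIntegrable]
        with t ht _
      refine ((hasDerivAt_exp_mul_ofReal κ t).mul ((ht 0).const_sub C)).congr_deriv ?_
      simp only [w, I]
      rw [mul_neg, ← mul_assoc (Complex.exp (κ * t)), ← Complex.exp_add]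
      simp
      ring)
      (hwi.sub (hFii 0 x))
    rw [this]
    simp [w]
  have hwL : MemLp w 2 (volume.restrict (Ici 0)) := by
    refine memLp_of_exp_kernel hκ hF hwc (s := Ioi)
      (a := fun x t => Complex.exp (κ * ((x - t : ℝ) : ℂ))) (fun _ => measurableSet_Ioi)
      (fun x t ht => ?_) fun x hx => ?_
    · rw [norm_exp_mul_ofReal, abs_of_neg (sub_neg.2 ht)]
      exact le_of_eq (by ring_nf)
    · simp only [w]
      rw [hI x hx, ← integral_const_mul]
      refine integral_congr_ae (Eventually.of_forall fun t => ?_)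
      simp only [← mul_assoc, ← Complex.exp_add]
      congr 2
      push_cast
      ring
  have hwE : Continuous fun t : ℝ => Complex.exp (κ * t) * w t := by fun_prop
  -- The second factor `u' + κ u = w` is solved forward from `u 0 = 0`, the direction in which its
  -- kernel `exp (-κ (x - t))` decays.
  let u : ℝ → ℂ := fun x => Complex.exp (-κ * x) * ∫ t in 0..x, Complex.exp (κ * (t : ℝ)) * w t
  have hu : ∀ x, HasDerivAt u (w x - κ * u x) x := by
    intro x
    refine ((hasDerivAt_exp_mul_ofReal (-κ) x).mul
      (hwE.integral_hasStrictDerivAt 0 x).hasDerivAt).congr_deriv ?_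
    rw [← mul_assoc (Complex.exp (-κ * x)), ← Complex.exp_add]
    simp [u]
    ring
  have huc : Continuous u := continuous_iff_continuousAt.2 fun x => (hu x).continuousAt
  have huL : MemLp u 2 (volume.restrict (Ici 0)) := by
    refine memLp_of_exp_kernel hκ ((memLp_indicator_iff_restrict measurableSet_Ici).2 hwL) huc
      (s := fun x => Ioc 0 x)
      (a := fun x t => Complex.exp (-κ * ((x - t : ℝ) : ℂ))) (fun _ => measurableSet_Ioc)
      (fun x t ht => ?_) fun x hx => ?_
    · rw [norm_exp_mul_ofReal, abs_of_nonneg (sub_nonneg.2 ht.2)]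
      exact le_of_eq (by simp)
    · simp only [u]
      rw [intervalIntegral.integral_of_le hx, ← integral_const_mul]
      refine setIntegral_congr_fun measurableSet_Ioc fun t ht => ?_
      rw [indicator_of_mem (show t ∈ Ici (0 : ℝ) from ht.1.le)]
      simp only [← mul_assoc, ← Complex.exp_add]
      congr 2
      push_cast
      ring
  have hd : Continuous fun x => w x - κ * u x := by fun_prop
  have hmem : MemLp (fun t => κ ^ 2 * u t - F t) 2 (volume.restrict (Ici 0)) :=
    (huL.const_mul _).sub (hF.restrict _)
  refine ⟨u, fun x => w x - κ * u x, fun x => κ ^ 2 * u x - F x,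
    isH2Rep_of_integral (c := w 0) hmem (fun x _ => (hu x).hasDerivWithinAt) fun x hx => ?_, huL,
    fun x hx => ?_⟩
  · have hux : u x = ∫ t in 0..x, (w t - κ * u t) := by
      rw [intervalIntegral.integral_eq_sub_of_hasDerivAt (fun t _ => hu t)
        (hd.intervalIntegrable _ _)]
      simp [u]
    -- The right side is `w' - κ u'`, which integrates to the required formula for `u' = w - κ u`.
    have e : ∀ t, κ ^ 2 * u t - F t = (κ * w t - F t) - κ * (w t - κ * u t) := fun t => by ring
    simp_rw [e]
    have hi1 : IntervalIntegrable (fun t => κ * w t - F t) volume 0 x :=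
      ((continuous_const.mul hwc).intervalIntegrable _ _).sub (hFii 0 x)
    have hi2 : IntervalIntegrable (fun t => κ * (w t - κ * u t)) volume 0 x :=
      (continuous_const.mul hd).intervalIntegrable _ _
    rw [intervalIntegral.integral_sub hi1 hi2, intervalIntegral.integral_const_mul,
      ← hux, hwint x hx]
    ring
  · simp only [F, indicator_of_mem hx]
    ring

/-- The square integrable solution of the homogeneous equation on the lead. -/
theorem isH2Rep_lead_exp (E : Type*) (ℓ : ℝ) {κ : ℂ} (hκ : 0 < κ.re) :
    IsH2Rep (edgeInterval ℓ (none : Option E)) (fun x : ℝ => Complex.exp (-κ * x))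
      (fun x : ℝ => Complex.exp (-κ * x)) (fun x : ℝ => -κ * Complex.exp (-κ * x))
      (fun x : ℝ => -κ * (-κ * Complex.exp (-κ * x))) := by
  have hκ' : (-κ).re < 0 := by simpa using hκ
  refine isH2Rep_of_integral (c := -κ) (((memLp_exp hκ').const_mul _).const_mul _)
    (fun x _ => (hasDerivAt_exp_mul_ofReal (-κ) x).hasDerivWithinAt) fun x _ => ?_
  rw [intervalIntegral.integral_eq_sub_of_hasDerivAt
    (fun t _ => (hasDerivAt_exp_mul_ofReal (-κ) t).const_mul (-κ))
    (Continuous.intervalIntegrable (by fun_prop) _ _)]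
  simp

end LeadGraph

/-! ### Solving `A y - z y = f`: matching edge solutions at the vertices -/

namespace LeadGraph

/-- This is where connectedness enters: no vertex is isolated, so the vertex values are determined
by the functions on the edges. The lead serves the root, which covers the graph with a single
vertex. -/
theorem exists_initialVertex_or_tgt {V : Type*} {G : SimpleGraph V}
    (hG : G.Connected) (o : EdgeOrientation G) (root v : V) :
    (∃ e, initialVertex o root e = v) ∨ ∃ e, o.tgt e = v := by
  obtain ⟨p⟩ := hG.preconnected v root
  cases p with
  | nil => exact Or.inl ⟨none, rfl⟩
  | @cons _ w _ hadj _ =>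
    let e : G.edgeSet := ⟨s(v, w), hadj⟩
    rcases Sym2.eq_iff.1 (o.endpoints e) with ⟨h, -⟩ | ⟨-, h⟩
    · exact Or.inl ⟨some e, h⟩
    · exact Or.inr ⟨e, h⟩

variable {V : Type*} [DecidableEq V] {G : SimpleGraph V} [Fintype G.edgeSet]
  {o : EdgeOrientation G} {root : V} {ℓ : ℝ} {q : G.edgeSet → ℝ → ℝ}

/-- `u` is a square integrable solution of `-u'' + q u - z u = f` on the edge `e`. -/
structure IsEdgeSolution {E : Type*} (ℓ : ℝ) (q : E → ℝ → ℝ) (z : ℂ) (e : Option E)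
    (f u u' u'' : ℝ → ℂ) : Prop where
  rep : IsH2Rep (edgeInterval ℓ e) u u u' u''
  memLp : MemLp u 2 (volume.restrict (edgeInterval ℓ e))
  eqn : ∀ᵐ x ∂(volume.restrict (edgeInterval ℓ e)),
    -u'' x + (extendByZero q e x : ℂ) * u x - z * u x = f x

theorem IsEdgeSolution.add {E : Type*} {q : E → ℝ → ℝ} {z : ℂ} {e : Option E}
    {f g u u' u'' v v' v'' : ℝ → ℂ} (h : IsEdgeSolution ℓ q z e f u u' u'')
    (k : IsEdgeSolution ℓ q z e g v v' v'') :
    IsEdgeSolution ℓ q z e (fun x => f x + g x) (fun x => u x + v x) (fun x => u' x + v' x)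
      (fun x => u'' x + v'' x) where
  rep := h.rep.add k.rep (ae_eq_refl _)
  memLp := h.memLp.add k.memLp
  eqn := by
    filter_upwards [h.eqn, k.eqn] with x h1 h2
    rw [← h1, ← h2]
    ring

theorem IsEdgeSolution.smul {E : Type*} {q : E → ℝ → ℝ} {z : ℂ} {e : Option E}
    {f u u' u'' : ℝ → ℂ} (c : ℂ) (h : IsEdgeSolution ℓ q z e f u u' u'') :
    IsEdgeSolution ℓ q z e (fun x => c * f x) (fun x => c * u x) (fun x => c * u' x)
      (fun x => c * u'' x) where
  rep := h.rep.smul c (ae_eq_refl _)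
  memLp := h.memLp.const_mul c
  eqn := by
    filter_upwards [h.eqn] with x h1
    rw [← h1]
    ring

theorem IsEdgeSolution.zero {E : Type*} (ℓ : ℝ) (q : E → ℝ → ℝ) (z : ℂ) (e : Option E) :
    IsEdgeSolution ℓ q z e (fun _ => 0) (fun _ => 0) (fun _ => 0) (fun _ => 0) where
  rep := IsH2Rep.zero _ (ae_eq_refl _)
  memLp := MemLp.zero'
  eqn := Eventually.of_forall fun x => by simp

theorem exists_isEdgeSolution_some {E : Type*} {q : E → ℝ → ℝ} (hℓ : 0 < ℓ) {e : E}
    (hq : MemLp (q e) 2 (volume.restrict (Icc 0 ℓ))) (z : ℂ) {f : ℝ → ℂ}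
    (hf : MemLp f 2 (volume.restrict (Icc 0 ℓ))) (a b : ℂ) :
    ∃ u u' u'' : ℝ → ℂ, IsEdgeSolution ℓ q z (some e) f u u' u'' ∧ u 0 = a ∧ u' 0 = b := by
  have hp : MemLp (fun x => (q e x : ℂ) - z) 2 (volume.restrict (Icc 0 ℓ)) :=
    hq.ofReal.sub (memLp_const z)
  obtain ⟨u, u', u'', h, ha, hb, heq⟩ := exists_edge_solution e hℓ hp hf a b
  refine ⟨u, u', u'', ⟨h, ?_, ?_⟩, ha, hb⟩
  · obtain ⟨C, hC⟩ := isCompact_Icc.exists_bound_of_continuousOn h.continuousOn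
    have : MemLp u 2 (volume.restrict (Icc 0 ℓ)) :=
      MemLp.of_bound (h.continuousOn.aestronglyMeasurable measurableSet_Icc) C
        (ae_restrict_of_forall_mem measurableSet_Icc hC)
    exact this
  · refine ae_restrict_of_forall_mem measurableSet_Icc fun x hx => ?_
    rw [← heq x hx]
    simp only [extendByZero]
    ring

theorem exists_isEdgeSolution_none {E : Type*} (ℓ : ℝ) (q : E → ℝ → ℝ) {κ : ℂ} (hκ : 0 < κ.re)
    {f : ℝ → ℂ} (hf : MemLp f 2 (volume.restrict (Ici 0))) :
    ∃ u u' u'' : ℝ → ℂ, IsEdgeSolution ℓ q (-κ ^ 2) none f u u' u'' := by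
  obtain ⟨u, u', u'', h, hL, heq⟩ := exists_lead_solution E ℓ hκ hf
  refine ⟨u, u', u'', h, hL, ae_restrict_of_forall_mem measurableSet_Ici fun x hx => ?_⟩
  rw [← heq x hx]
  simp only [extendByZero, Complex.ofReal_zero]
  ring

theorem isEdgeSolution_lead_exp {E : Type*} (ℓ : ℝ) (q : E → ℝ → ℝ) {κ : ℂ} (hκ : 0 < κ.re) :
    IsEdgeSolution ℓ q (-κ ^ 2) none (fun _ => 0) (fun x : ℝ => Complex.exp (-κ * x))
      (fun x : ℝ => -κ * Complex.exp (-κ * x))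
      (fun x : ℝ => -κ * (-κ * Complex.exp (-κ * x))) where
  rep := isH2Rep_lead_exp E ℓ hκ
  memLp := memLp_exp (by simpa using hκ)
  eqn := Eventually.of_forall fun x => by
    simp only [extendByZero, Complex.ofReal_zero]
    ring

theorem exists_domain_of_isEdgeSolution (hℓ : 0 < ℓ) {z : ℂ} (f : L2Space G.edgeSet ℓ)
    {u u' u'' : Option G.edgeSet → ℝ → ℂ}
    (h : ∀ e, IsEdgeSolution ℓ q z e (f e) (u e) (u' e) (u'' e))
    (hc : ContinuousAtVertices o root ℓ u) (hk : Kirchhoff o root ℓ u') :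
    ∃ y : (schrodingerOperator o root ℓ q).domain,
      schrodingerOperator o root ℓ q y - z • (y : L2Space G.edgeSet ℓ) = f ∧
      ∀ e, (y : L2Space G.edgeSet ℓ) e =ᵐ[volume.restrict (edgeInterval ℓ e)] u e := by
  let y : L2Space G.edgeSet ℓ := WithLp.toLp 2 fun e => (h e).memLp.toLp
  have hy : ∀ e, y e =ᵐ[volume.restrict (edgeInterval ℓ e)] u e := fun e =>
    (h e).memLp.coeFn_toLp
  have hg : IsGraphPair o root ℓ q y (z • y + f) := by
    refine ⟨u, u', u'', fun e => ⟨hy e, (h e).rep.deriv_one, (h e).rep.abs_cont,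
      (h e).rep.deriv_two, (h e).rep.memLp_two⟩, hc, hk, fun e => ?_⟩
    refine (Lp.coeFn_add ((z • y) e) (f e)).trans ?_
    filter_upwards [Lp.coeFn_smul z (y e), hy e, (h e).eqn] with x h1 h2 h3
    have h1' : ((z • y) e : ℝ → ℂ) x = z * u e x := by
      refine h1.trans ?_
      rw [Pi.smul_apply, h2, smul_eq_mul]
    rw [Pi.add_apply, h1', ← h3]
    ring
  obtain ⟨t, ht, hAt⟩ := exists_domain_of_isGraphPair hℓ hg
  exact ⟨t, by rw [hAt, ht]; abel, by rw [ht]; exact hy⟩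

/-- Allows the initial data of a solution to be read off from its `L²` class. -/
theorem IsH2Rep.eq_zero_of_ae_eq_zero {E : Type*} (hℓ : 0 < ℓ) {e : Option E}
    {f u u' u'' : ℝ → ℂ} (h : IsH2Rep (edgeInterval ℓ e) f u u' u'')
    (hf : f =ᵐ[volume.restrict (edgeInterval ℓ e)] fun _ => 0) : u 0 = 0 ∧ u' 0 = 0 := by
  have h0 := (h.second_eq_zero hℓ e hf).1
  have hmem : (0 : ℝ) ∈ edgeInterval ℓ e := by
    cases e
    · exact le_refl (0 : ℝ)
    · exact left_mem_Icc.2 hℓ.le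
  have hU : UniqueDiffWithinAt ℝ (edgeInterval ℓ e) 0 := by
    cases e
    · exact uniqueDiffOn_Ici 0 0 hmem
    · exact uniqueDiffOn_Icc hℓ 0 hmem
  exact ⟨h0 0 hmem, hU.eq_deriv _ (h.deriv_one 0 hmem)
    ((hasDerivWithinAt_const 0 _ (0 : ℂ)).congr h0 (h0 0 hmem))⟩

/-- The defects of the vertex conditions, for functions with values `c` at the vertices. -/
def vertexDefect (o : EdgeOrientation G) (root : V) (ℓ : ℝ) (u u' : Option G.edgeSet → ℝ → ℂ)
    (c : V → ℂ) : (Option G.edgeSet → ℂ) × (G.edgeSet → ℂ) × (V → ℂ) :=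
  (fun e => u e 0 - c (initialVertex o root e), fun e => u (some e) ℓ - c (o.tgt e),
    fun v => ∑ e with o.tgt e = v, u' (some e) ℓ - ∑ e with initialVertex o root e = v, u' e 0)

theorem vertex_conditions_of_defect_eq_zero {u u' : Option G.edgeSet → ℝ → ℂ} {c : V → ℂ}
    (h : vertexDefect o root ℓ u u' c = 0) :
    ContinuousAtVertices o root ℓ u ∧ Kirchhoff o root ℓ u' := by
  rw [vertexDefect, Prod.ext_iff, Prod.ext_iff] at h
  obtain ⟨h1, h2, h3⟩ := h
  exact ⟨⟨c, fun e => sub_eq_zero.1 (congrFun h1 e), fun e => sub_eq_zero.1 (congrFun h2 e)⟩,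
    fun v => sub_eq_zero.1 (congrFun h3 v)⟩

/-- The vertex defect of the solutions `α φ + β ψ`, where `β` vanishes on the lead. -/
def defectMap (o : EdgeOrientation G) (root : V) (ℓ : ℝ) (φ φ' ψ ψ' : Option G.edgeSet → ℝ → ℂ) :
    (Option G.edgeSet → ℂ) × (G.edgeSet → ℂ) × (V → ℂ) →ₗ[ℂ]
      (Option G.edgeSet → ℂ) × (G.edgeSet → ℂ) × (V → ℂ) where
  toFun a := vertexDefect o root ℓ
    (fun e x => a.1 e * φ e x + e.elim 0 a.2.1 * ψ e x)
    (fun e x => a.1 e * φ' e x + e.elim 0 a.2.1 * ψ' e x) a.2.2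
  map_add' a b := by
    have hB : ∀ e : Option G.edgeSet,
        e.elim 0 (a + b).2.1 = e.elim 0 a.2.1 + e.elim 0 b.2.1 := by
      rintro (_ | e) <;> simp
    simp only [vertexDefect, hB]
    refine Prod.ext (funext fun e => ?_) (Prod.ext (funext fun e => ?_) (funext fun v => ?_))
    · simp only [Prod.fst_add, Prod.snd_add, Pi.add_apply]
      ring
    · simp only [Prod.fst_add, Prod.snd_add, Pi.add_apply]
      ring
    · simp only [Prod.fst_add, Prod.snd_add, Pi.add_apply, add_mul, Finset.sum_add_distrib]
      ring
  map_smul' r a := by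
    have hB : ∀ e : Option G.edgeSet, e.elim 0 (r • a).2.1 = r * e.elim 0 a.2.1 := by
      rintro (_ | e) <;> simp
    simp only [vertexDefect, hB]
    refine Prod.ext (funext fun e => ?_) (Prod.ext (funext fun e => ?_) (funext fun v => ?_))
    · simp only [Prod.smul_fst, Prod.smul_snd, Pi.smul_apply, smul_eq_mul, RingHom.id_apply]
      ring
    · simp only [Prod.smul_fst, Prod.smul_snd, Pi.smul_apply, smul_eq_mul, RingHom.id_apply]
      ring
    · simp only [Prod.smul_fst, Prod.smul_snd, Pi.smul_apply, smul_eq_mul, RingHom.id_apply,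
        mul_sub, Finset.mul_sum, mul_add, mul_assoc]

/-- Of the two square roots of `-z`, one has positive real part, unless both are purely imaginary,
in which case `z` is the square of a real number. -/
theorem exists_sq_eq_neg {z : ℂ} (hz : z ∉ (fun x : ℝ => (x : ℂ)) '' Ici 0) :
    ∃ κ : ℂ, 0 < κ.re ∧ z = -κ ^ 2 := by
  obtain ⟨w, hw⟩ := IsAlgClosed.exists_pow_nat_eq (-z) two_pos
  rcases lt_trichotomy w.re 0 with h | h | h
  · exact ⟨-w, by simpa using h, by rw [neg_sq, hw, neg_neg]⟩
  · refine absurd ⟨w.im ^ 2, mem_Ici.2 (sq_nonneg _), ?_⟩ hz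
    have hw' : w = w.im * Complex.I := by
      apply Complex.ext <;> simp [h]
    have : z = -w ^ 2 := by rw [hw, neg_neg]
    rw [this, hw']
    simp [mul_pow]
  · exact ⟨w, h, by rw [hw, neg_neg]⟩

/-- Off `[0, ∞)`, injectivity of `A - z` implies surjectivity. -/
theorem surjective_of_injective [Finite V] (hG : G.Connected) (hℓ : 0 < ℓ)
    (hq : ∀ e, MemLp (q e) 2 (volume.restrict (Icc 0 ℓ))) {z : ℂ}
    (hz : z ∉ (fun x : ℝ => (x : ℂ)) '' Ici 0)
    (hinj : ∀ y : (schrodingerOperator o root ℓ q).domain,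
      schrodingerOperator o root ℓ q y = z • (y : L2Space G.edgeSet ℓ) → y = 0)
    (f : L2Space G.edgeSet ℓ) :
    ∃ y : (schrodingerOperator o root ℓ q).domain,
      schrodingerOperator o root ℓ q y - z • (y : L2Space G.edgeSet ℓ) = f := by
  obtain ⟨κ, hκ, rfl⟩ := exists_sq_eq_neg hz
  -- `φ` and `ψ` form a fundamental system on each finite edge. On the lead only the decaying
  -- exponential is square integrable, so `ψ` is zero there and the slope conditions exempt `none`.
  have hφ : ∀ e : Option G.edgeSet, ∃ u u' u'' : ℝ → ℂ,
      IsEdgeSolution ℓ q (-κ ^ 2) e (fun _ => 0) u u' u'' ∧ u 0 = 1 ∧ (e ≠ none → u' 0 = 0) := by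
    rintro (_ | e)
    · exact ⟨_, _, _, isEdgeSolution_lead_exp ℓ q hκ, by simp, by simp⟩
    · obtain ⟨u, u', u'', h, h0, h1⟩ :=
        exists_isEdgeSolution_some hℓ (hq e) (-κ ^ 2) (f := fun _ => 0) MemLp.zero' 1 0
      exact ⟨u, u', u'', h, h0, fun _ => h1⟩
  have hψ : ∀ e : Option G.edgeSet, ∃ u u' u'' : ℝ → ℂ,
      IsEdgeSolution ℓ q (-κ ^ 2) e (fun _ => 0) u u' u'' ∧ u 0 = 0 ∧ (e ≠ none → u' 0 = 1) := by
    rintro (_ | e)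
    · exact ⟨_, _, _, IsEdgeSolution.zero ℓ q _ none, rfl, by simp⟩
    · obtain ⟨u, u', u'', h, h0, h1⟩ :=
        exists_isEdgeSolution_some hℓ (hq e) (-κ ^ 2) (f := fun _ => 0) MemLp.zero' 0 1
      exact ⟨u, u', u'', h, h0, fun _ => h1⟩
  have hp : ∀ e : Option G.edgeSet, ∃ u u' u'' : ℝ → ℂ,
      IsEdgeSolution ℓ q (-κ ^ 2) e (f e) u u' u'' := by
    rintro (_ | e)
    · exact exists_isEdgeSolution_none ℓ q hκ (Lp.memLp (f none))
    · obtain ⟨u, u', u'', h, -⟩ :=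
        exists_isEdgeSolution_some hℓ (hq e) (-κ ^ 2) (Lp.memLp (f (some e))) 0 0
      exact ⟨u, u', u'', h⟩
  choose φ φ' φ'' hφ hφ0 hφ1 using hφ
  choose ψ ψ' ψ'' hψ hψ0 hψ1 using hψ
  choose p p' p'' hp using hp
  have hsol : ∀ (α : Option G.edgeSet → ℂ) (β : G.edgeSet → ℂ) (e : Option G.edgeSet),
      IsEdgeSolution ℓ q (-κ ^ 2) e (fun _ => 0)
        (fun x => α e * φ e x + e.elim 0 β * ψ e x)
        (fun x => α e * φ' e x + e.elim 0 β * ψ' e x)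
        (fun x => α e * φ'' e x + e.elim 0 β * ψ'' e x) := fun α β e => by
    simpa using ((hφ e).smul (α e)).add ((hψ e).smul (e.elim 0 β))
  -- Coefficients with zero defect define a solution of `A y = z y`, which `hinj` makes zero. Its
  -- value and slope at the initial end of each edge then give `α = 0` and `β = 0`, and the
  -- continuity conditions give `c = 0`.
  have hΦ : Function.Injective (defectMap o root ℓ φ φ' ψ ψ') := by
    rw [injective_iff_map_eq_zero]
    rintro ⟨α, β, c⟩ h
    obtain ⟨hc, hk⟩ := vertex_conditions_of_defect_eq_zero (show vertexDefect o root ℓ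
      (fun e x => α e * φ e x + e.elim 0 β * ψ e x)
      (fun e x => α e * φ' e x + e.elim 0 β * ψ' e x) c = 0 from h)
    obtain ⟨y, hy, hyu⟩ := exists_domain_of_isEdgeSolution (q := q) (z := -κ ^ 2) hℓ
      (0 : L2Space G.edgeSet ℓ)
      (fun e => by
        obtain ⟨h1, h2, h3⟩ := hsol α β e
        refine ⟨h1, h2, ?_⟩
        filter_upwards [h3, Lp.coeFn_zero ℂ 2 (volume.restrict (edgeInterval ℓ e))] with x hx hx0
        rw [hx]
        exact hx0.symm) hc hk
    have hy0 := hinj y (sub_eq_zero.1 hy)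
    have hu : ∀ e, α e * φ e 0 + e.elim 0 β * ψ e 0 = 0 ∧
        α e * φ' e 0 + e.elim 0 β * ψ' e 0 = 0 := fun e => by
      refine (hsol α β e).rep.eq_zero_of_ae_eq_zero hℓ ((hyu e).symm.trans ?_)
      rw [hy0]
      exact Lp.coeFn_zero ℂ 2 (volume.restrict (edgeInterval ℓ e))
    have hα : α = 0 := funext fun e => by simpa [hφ0, hψ0] using (hu e).1
    have hβ : β = 0 := funext fun e => by
      simpa [hα, hψ1] using (hu (some e)).2
    have hc0 : c = 0 := funext fun v => by
      rcases exists_initialVertex_or_tgt hG o root v with ⟨e, he⟩ | ⟨e, he⟩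
      · have := congrFun (congrArg Prod.fst h) e
        simpa [defectMap, vertexDefect, hα, hβ, hψ0, he] using this
      · have := congrFun (congrArg (fun a => a.2.1) h) e
        simpa [defectMap, vertexDefect, hα, hβ, he] using this
    rw [hα, hβ, hc0]
    rfl
  -- The defect map is an endomorphism of a finite-dimensional space: there are as many vertex
  -- conditions as free parameters. Being injective, it can cancel the defect of the particular
  -- solution `p`.
  obtain ⟨⟨α, β, c⟩, hα⟩ := (LinearMap.injective_iff_surjective.1 hΦ)
    (-vertexDefect o root ℓ p p' 0)
  have hdef : vertexDefect o root ℓ (fun e x => (α e * φ e x + e.elim 0 β * ψ e x) + p e x)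
      (fun e x => (α e * φ' e x + e.elim 0 β * ψ' e x) + p' e x) c = 0 := by
    rw [eq_neg_iff_add_eq_zero] at hα
    rw [← hα]
    refine Prod.ext (funext fun e => ?_) (Prod.ext (funext fun e => ?_) (funext fun v => ?_))
    · simp only [defectMap, vertexDefect, LinearMap.coe_mk, AddHom.coe_mk, Prod.fst_add,
        Pi.add_apply, Pi.zero_apply]
      ring
    · simp only [defectMap, vertexDefect, LinearMap.coe_mk, AddHom.coe_mk, Prod.fst_add,
        Prod.snd_add, Pi.add_apply, Pi.zero_apply]
      ring
    · simp only [defectMap, vertexDefect, LinearMap.coe_mk, AddHom.coe_mk, Prod.snd_add,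
        Pi.add_apply, Finset.sum_add_distrib]
      ring
  obtain ⟨hc, hk⟩ := vertex_conditions_of_defect_eq_zero hdef
  obtain ⟨y, hy, -⟩ := exists_domain_of_isEdgeSolution (q := q) (z := -κ ^ 2) hℓ f
    (fun e => by simpa using (hsol α β e).add (hp e)) hc hk
  exact ⟨y, hy⟩

end LeadGraph

/-! ### Approximate eigenfunctions on the lead -/

namespace LeadGraph

theorem integral_pow_mul_exp_neg {b : ℝ} (hb : 0 < b) (n : ℕ) :
    IntegrableOn (fun x : ℝ => x ^ n * Real.exp (-(b * x))) (Ici 0) ∧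
      ∫ x in Ici 0, x ^ n * Real.exp (-(b * x)) = n.factorial / b ^ (n + 1) := by
  have h : ∫ x in Ioi 0, x ^ n * Real.exp (-(b * x)) = n.factorial / b ^ (n + 1) := by
    have := Real.integral_rpow_mul_exp_neg_mul_Ioi (a := n + 1) (r := b) (by positivity) hb
    rw [Real.Gamma_nat_eq_factorial] at this
    simp only [add_sub_cancel_right, Real.rpow_natCast] at this
    rw [this, ← Nat.cast_add_one, Real.rpow_natCast, one_div, inv_pow]
    exact inv_mul_eq_div _ _
  rw [integrableOn_Ici_iff_integrableOn_Ioi, integral_Ici_eq_integral_Ioi]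
  -- A non-integrable function has integral zero by convention, so the nonzero value already proves
  -- integrability.
  exact ⟨Integrable.of_integral_ne_zero (h ▸ by positivity), h⟩

theorem norm_sq_pow_mul_exp {s : ℝ → ℂ} {a : ℂ} {n : ℕ} {x : ℝ} (hx : 0 ≤ x)
    (hs : s x = x ^ n * Complex.exp (a * x)) :
    ‖s x‖ ^ 2 = x ^ (2 * n) * Real.exp (-(-2 * a.re * x)) := by
  rw [hs, norm_mul, norm_pow, Complex.norm_real, Real.norm_eq_abs, abs_of_nonneg hx,
    norm_exp_mul_ofReal, mul_pow, ← pow_mul, mul_comm n, ← Real.exp_nat_mul]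
  congr 2
  push_cast
  ring

theorem memLp_pow_mul_exp {a : ℂ} (ha : a.re < 0) (n : ℕ) :
    MemLp (fun x : ℝ => (x : ℂ) ^ n * Complex.exp (a * x)) 2 (volume.restrict (Ici 0)) := by
  rw [memLp_two_iff_integrable_sq_norm (Continuous.aestronglyMeasurable (by fun_prop))]
  refine ((integral_pow_mul_exp_neg (b := -2 * a.re) (by linarith) (2 * n)).1).congr ?_
  exact ae_restrict_of_forall_mem measurableSet_Ici fun x hx => 
    (norm_sq_pow_mul_exp (s := fun x => (x : ℂ) ^ n * Complex.exp (a * x)) hx rfl).symm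

theorem norm_sq_toLp_pow_mul_exp {a : ℂ} (ha : a.re < 0) (n : ℕ) :
    ‖(memLp_pow_mul_exp ha n).toLp‖ ^ 2 =
      (2 * n).factorial / (-2 * a.re) ^ (2 * n + 1) := by
  rw [← (integral_pow_mul_exp_neg (b := -2 * a.re) (by linarith) (2 * n)).2,
    norm_sq_eq_re_inner (𝕜 := ℂ),
    inner_eq_integral _ _ (memLp_pow_mul_exp ha n).coeFn_toLp (memLp_pow_mul_exp ha n).coeFn_toLp]
  have e : ∫ x in Ici (0 : ℝ), conj ((x : ℂ) ^ n * Complex.exp (a * x)) *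
      ((x : ℂ) ^ n * Complex.exp (a * x)) =
      ∫ x in Ici (0 : ℝ), ((x ^ (2 * n) * Real.exp (-(-2 * a.re * x)) : ℝ) : ℂ) := by
    refine setIntegral_congr_fun measurableSet_Ici fun x hx => ?_
    simp only [← norm_sq_pow_mul_exp (s := fun x => (x : ℂ) ^ n * Complex.exp (a * x)) hx rfl]
    rw [Complex.conj_mul']
    push_cast
    rfl
  rw [e]
  exact (congrArg Complex.re integral_ofReal).trans (Complex.ofReal_re _)

variable {V : Type*} [DecidableEq V] {G : SimpleGraph V} [Fintype G.edgeSet]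
  {o : EdgeOrientation G} {root : V} {ℓ : ℝ} {q : G.edgeSet → ℝ → ℝ}

/-- The extension by zero of a function on the lead. -/
def leadExtension (E : Type*) (ℓ : ℝ) (g : Lp ℂ 2 (volume.restrict (Ici (0 : ℝ)))) :
    L2Space E ℓ :=
  WithLp.toLp 2 fun e => match e with
    | none => g
    | some _ => 0

theorem norm_leadExtension {E : Type*} [Fintype E] (ℓ : ℝ)
    (g : Lp ℂ 2 (volume.restrict (Ici (0 : ℝ)))) : ‖leadExtension E ℓ g‖ = ‖g‖ := by
  rw [← sq_eq_sq₀ (norm_nonneg _) (norm_nonneg _), PiLp.norm_sq_eq_of_L2, Fintype.sum_option]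
  exact add_eq_left.2 (Finset.sum_eq_zero fun e _ => by simp [leadExtension])

theorem smul_leadExtension_sub {E : Type*} (ℓ : ℝ) (r : ℂ)
    (g h : Lp ℂ 2 (volume.restrict (Ici (0 : ℝ)))) :
    r • leadExtension E ℓ g - leadExtension E ℓ h = leadExtension E ℓ (r • g - h) := by
  ext1 e
  cases e with
  | none => rfl
  | some e =>
    change r • (0 : Lp ℂ 2 (volume.restrict (edgeInterval ℓ (some e)))) - 0 = 0
    rw [smul_zero, sub_zero]

/-- A function on the lead that vanishes to first order at the root belongs, extended by zero, to
the domain of the operator. -/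
theorem exists_domain_of_lead (hℓ : 0 < ℓ) {u u' u'' : ℝ → ℂ}
    (h : IsH2Rep (edgeInterval ℓ (none : Option G.edgeSet)) u u u' u'') (h0 : u 0 = 0)
    (h1 : u' 0 = 0) {g w : Lp ℂ 2 (volume.restrict (Ici (0 : ℝ)))}
    (hg : g =ᵐ[volume.restrict (Ici 0)] u) (hw : w =ᵐ[volume.restrict (Ici 0)] fun x => -u'' x) :
    ∃ y : (schrodingerOperator o root ℓ q).domain,
      ‖(y : L2Space G.edgeSet ℓ)‖ = ‖g‖ ∧
      ∀ r : ℂ, ‖r • (y : L2Space G.edgeSet ℓ) - schrodingerOperator o root ℓ q y‖ =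
        ‖r • g - w‖ := by
  have hpair : IsGraphPair o root ℓ q (leadExtension _ ℓ g) (leadExtension _ ℓ w) := by
    refine ⟨fun e => e.elim u fun _ _ => 0, fun e => e.elim u' fun _ _ => 0,
      fun e => e.elim u'' fun _ _ => 0, ?_, ⟨0, ?_, fun e => rfl⟩, ?_, ?_⟩
    · rintro (_ | e)
      · exact ⟨hg, h.deriv_one, h.abs_cont, h.deriv_two, h.memLp_two⟩
      · exact IsH2Rep.zero _ (Lp.coeFn_zero _ _ _)
    · rintro (_ | e)
      · exact h0
      · rfl
    · intro v
      refine (Finset.sum_eq_zero fun e _ => rfl).trans (Finset.sum_eq_zero ?_).symm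
      rintro (_ | e) _
      · exact h1
      · rfl
    · rintro (_ | e)
      · exact hw.trans (Eventually.of_forall fun x => by simp [extendByZero])
      · exact (Lp.coeFn_zero ℂ 2 (volume.restrict (edgeInterval ℓ (some e)))).trans
          (Eventually.of_forall fun x => by simp)
  obtain ⟨y, hy, hAy⟩ := exists_domain_of_isGraphPair hℓ hpair
  refine ⟨y, by rw [hy, norm_leadExtension], fun r => ?_⟩
  rw [hy, hAy, smul_leadExtension_sub, norm_leadExtension]

/-- Every point of `[0, ∞)` is an approximate eigenvalue. -/
theorem exists_approx_eigenvector (hℓ : 0 < ℓ) {r : ℝ} (hr : 0 ≤ r) {η : ℝ} (hη : 0 < η) :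
    ∃ y : (schrodingerOperator o root ℓ q).domain,
      ‖(r : ℂ) • (y : L2Space G.edgeSet ℓ) - schrodingerOperator o root ℓ q y‖ <
        η * ‖(y : L2Space G.edgeSet ℓ)‖ := by
  set k := √r
  have hk : k ^ 2 = r := Real.sq_sqrt hr
  have hk0 : 0 ≤ k := Real.sqrt_nonneg r
  -- The constant comes from the final estimate: `8 ε² + 8 ε (ε + k) + ε² + 2 ε k = 17 ε² + 10 k ε`,
  -- which is at most `(17 + 10 k) ε` because `ε ≤ 1`.
  obtain ⟨ε, hε, hε1, hεη⟩ : ∃ ε : ℝ, 0 < ε ∧ ε ≤ 1 ∧ (17 + 10 * k) * ε < η := by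
    refine ⟨min 1 (η / (2 * (17 + 10 * k))), by positivity, min_le_left _ _, ?_⟩
    calc _ ≤ (17 + 10 * k) * (η / (2 * (17 + 10 * k))) := by
          gcongr
          exact min_le_right _ _
      _ = η / 2 := by field_simp
      _ < η := half_lt_self hη
  set a : ℂ := -ε + k * Complex.I
  have har : a.re = -ε := by simp [a]
  have ha : a.re < 0 := by rw [har]; linarith
  have hd0 : ∀ x : ℝ, HasDerivAt (fun x : ℝ => (x : ℂ)) 1 x := fun x =>
    Complex.ofRealCLM.hasDerivAt (x := x)
  -- A wave of frequency `k = √r` with slow decay `ε`. The factor `x²` makes both `u` and `u'`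
  -- vanish at the root, so that extension by zero satisfies all vertex conditions.
  set u : ℝ → ℂ := fun x => (x : ℂ) ^ 2 * Complex.exp (a * x)
  set u' : ℝ → ℂ := fun x => (2 * x + a * x ^ 2) * Complex.exp (a * x)
  set u'' : ℝ → ℂ := fun x => 2 * ((x : ℂ) ^ 0 * Complex.exp (a * x)) +
    4 * a * ((x : ℂ) ^ 1 * Complex.exp (a * x)) + a ^ 2 * ((x : ℂ) ^ 2 * Complex.exp (a * x))
  have hu : ∀ x, HasDerivAt u (u' x) x := fun x => by
    refine (((hd0 x).pow 2).mul (hasDerivAt_exp_mul_ofReal a x)).congr_deriv ?_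
    simp only [u', Pi.pow_apply]
    push_cast
    ring
  have hu' : ∀ x, HasDerivAt u' (u'' x) x := fun x => by
    refine ((((hd0 x).const_mul 2).add (((hd0 x).pow 2).const_mul a)).mul
      (hasDerivAt_exp_mul_ofReal a x)).congr_deriv ?_
    simp only [u'', Pi.pow_apply, Pi.add_apply]
    push_cast
    ring
  have m0 := memLp_pow_mul_exp ha 0
  have m1 := memLp_pow_mul_exp ha 1
  have m2 := memLp_pow_mul_exp ha 2
  have hmem : MemLp u'' 2 (volume.restrict (Ici 0)) :=
    ((m0.const_mul 2).add (m1.const_mul (4 * a))).add (m2.const_mul (a ^ 2))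
  have hrep : IsH2Rep (edgeInterval ℓ (none : Option G.edgeSet)) u u u' u'' := by
    refine isH2Rep_of_integral (c := 0) hmem (fun x _ => (hu x).hasDerivWithinAt) fun x _ => ?_
    rw [intervalIntegral.integral_eq_sub_of_hasDerivAt (fun t _ => hu' t)
      (Continuous.intervalIntegrable (by fun_prop) _ _)]
    simp [u']
  obtain ⟨y, hy, hAy⟩ := exists_domain_of_lead (o := o) (root := root) (q := q) hℓ hrep
    (by simp [u]) (by simp [u']) m2.coeFn_toLp (w := -hmem.toLp) (by
      filter_upwards [Lp.coeFn_neg hmem.toLp, hmem.coeFn_toLp] with x h1 h2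
      rw [h1, Pi.neg_apply, h2])
  refine ⟨y, ?_⟩
  rw [hy, hAy, sub_neg_eq_add]
  -- In `r u + u''` the leading coefficient `a² + r = ε² - 2 ε k i` is small; the other terms carry
  -- lower powers of `x`, whose norms are smaller than that of `u` by factors of order `ε` and `ε²`.
  have hcomb : (r : ℂ) • m2.toLp + hmem.toLp =
      (2 : ℂ) • m0.toLp + (4 * a) • m1.toLp + (a ^ 2 + r) • m2.toLp := by
    have : hmem.toLp = (2 : ℂ) • m0.toLp + (4 * a) • m1.toLp + (a ^ 2) • m2.toLp := rfl
    rw [this, add_smul]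
    abel
  have hn0 := norm_sq_toLp_pow_mul_exp ha 0
  have hn1 := norm_sq_toLp_pow_mul_exp ha 1
  have hn2 := norm_sq_toLp_pow_mul_exp ha 2
  rw [hcomb]
  change ‖m0.toLp‖ ^ 2 = _ at hn0
  change ‖m1.toLp‖ ^ 2 = _ at hn1
  change ‖m2.toLp‖ ^ 2 = _ at hn2
  set E0 := m0.toLp
  set E1 := m1.toLp
  set E2 := m2.toLp
  rw [har] at hn0 hn1 hn2
  norm_num [Nat.factorial] at hn0 hn1 hn2
  have hE2 : 0 < ‖E2‖ := by
    have : 0 < ‖E2‖ ^ 2 := by rw [hn2]; positivity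
    exact lt_of_le_of_ne (norm_nonneg _) fun h => by simp [← h] at this
  have hE0 : ‖E0‖ ≤ (2 * ε) ^ 2 * ‖E2‖ := by
    refine le_of_sq_le_sq ?_ (by positivity)
    rw [mul_pow, hn0, hn2]
    have : ((2 * ε) ^ 2) ^ 2 * (24 / (2 * ε) ^ 5) = 24 * (1 / (2 * ε)) := by field_simp
    rw [this]
    have : 0 < 1 / (2 * ε) := by positivity
    simp only [one_div, mul_inv] at *
    linarith
  have hE1 : ‖E1‖ ≤ (2 * ε) * ‖E2‖ := by
    refine le_of_sq_le_sq ?_ (by positivity)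
    rw [mul_pow, hn1, hn2]
    have : (2 * ε) ^ 2 * (24 / (2 * ε) ^ 5) = 12 * (2 / (2 * ε) ^ 3) := by field_simp; norm_num
    rw [this]
    have : 0 < 2 / (2 * ε) ^ 3 := by positivity
    linarith
  have hna : ‖a‖ ≤ ε + k := by
    refine (norm_add_le _ _).trans ?_
    rw [norm_neg, norm_mul, Complex.norm_I, mul_one, Complex.norm_real, Complex.norm_real,
      Real.norm_of_nonneg hε.le, Real.norm_of_nonneg hk0]
  have hna2 : ‖a ^ 2 + r‖ ≤ ε ^ 2 + 2 * ε * k := by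
    have : a ^ 2 + r = ((ε ^ 2 : ℝ) : ℂ) - ((2 * ε * k : ℝ) : ℂ) * Complex.I := by
      simp only [a, ← hk]
      push_cast
      linear_combination (k : ℂ) ^ 2 * Complex.I_sq
    rw [this]
    refine (norm_sub_le _ _).trans ?_
    rw [norm_mul, Complex.norm_I, mul_one, Complex.norm_real, Complex.norm_real,
      Real.norm_of_nonneg (by positivity), Real.norm_of_nonneg (by positivity)]
  calc ‖(2 : ℂ) • E0 + (4 * a) • E1 + (a ^ 2 + r) • E2‖
      ≤ ‖(2 : ℂ) • E0‖ + ‖(4 * a) • E1‖ + ‖(a ^ 2 + r) • E2‖ := norm_add₃_le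
    _ = 2 * ‖E0‖ + 4 * ‖a‖ * ‖E1‖ + ‖a ^ 2 + r‖ * ‖E2‖ := by
      rw [norm_smul, norm_smul, norm_smul, norm_mul]
      norm_num
    _ ≤ 2 * ((2 * ε) ^ 2 * ‖E2‖) + 4 * (ε + k) * ((2 * ε) * ‖E2‖) +
        (ε ^ 2 + 2 * ε * k) * ‖E2‖ := by gcongr
    _ = (17 * ε * ε + 10 * k * ε) * ‖E2‖ := by ring
    _ ≤ ((17 + 10 * k) * ε) * ‖E2‖ := by
      gcongr
      nlinarith
    _ < η * ‖E2‖ := by gcongr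

end LeadGraph

/-! ### The main theorem -/

theorem mainTheorem4 {V : Type*} [Fintype V] [DecidableEq V] (G : SimpleGraph V)
    [DecidableRel G.Adj] (hG : G.Connected) (o : EdgeOrientation G) (root : V)
    (ℓ : ℝ) (hℓ : 0 < ℓ) (q : G.edgeSet → ℝ → ℝ)
    (hq : ∀ e, MemLp (q e) 2 (volume.restrict (Icc 0 ℓ))) :
    IsSelfAdjoint (LeadGraph.schrodingerOperator o root ℓ q) ∧
    (LeadGraph.schrodingerOperator o root ℓ q).IsBoundedFromBelow ∧
    (LeadGraph.schrodingerOperator o root ℓ q).essSpec = (fun x : ℝ => (x : ℂ)) '' Ici 0 ∧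
    {x : ℝ | x < 0 ∧ (x : ℂ) ∈ (LeadGraph.schrodingerOperator o root ℓ q).spec}.Finite ∧
    ∀ x : ℝ, x < 0 → (x : ℂ) ∈ (LeadGraph.schrodingerOperator o root ℓ q).spec →
      (x : ℂ) ∈ (LeadGraph.schrodingerOperator o root ℓ q).normalEigenvalues := by
  obtain ⟨n, T, hT⟩ := LeadGraph.exists_finite_rank_bound (o := o) (root := root) hℓ hq
  exact LinearPMap.spectral_properties (LeadGraph.schrodingerOperator_isFormalAdjoint hℓ hq) T hT
    (fun z hz hi => LeadGraph.surjective_of_injective hG hℓ hq hz hi)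
    (fun r hr ε hε => LeadGraph.exists_approx_eigenvector hℓ hr hε)

end
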